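/- Let $d\ge 1$, $s\in(0,1)$ and $0<\lambda\le\Lambda$. Let $\mathcal K$ be the class of measurable functions $K:\mathbb R^d\to\mathbb R$ with $K(y)=K(-y)$ for all $y$ and $\lambda|y|^{-(d+s)}\le K(y)\le\Lambda|y|^{-(d+s)}$ for all $y\neq 0$. Notation. For a Borel set $E\subset\mathbb R^d$ put $\tilde\chi_E=\chi_{\mathbb R^d\setminus E}-\chi_E$ and, for $x\in\partial E$, $$H_{K,E}(x)=\lim_{\varepsilon\to0^+}\int_{\mathbb R^d\setminus B_\varepsilon(x)}\tilde\chi_E(y)\,K(x-y)\,dy\in[-\infty,+\infty].$$ We say that $H_{K,E}=0$ in $\mathbb R^d$ in the viscosity sense if $H_{K,E}(x)\le 0$ for every $x\in\partial E$ such that there is an open ball $B\subset\mathbb R^d\setminus E$ with $x\in\partial B$, and $H_{K,E}(x)\ge 0$ for every $x\in\partial E$ such that there is an open ball $B\subset E$ with $x\in\partial B$ (at all such points the limit exists). For $\alpha\in(0,1)$ and an open set $\Omega\subset\mathbb R^d$ let $$\operatorname{Per}_\alpha(E;\Omega)=\frac14\iint_{\mathbb R^{2d}\setminus((\mathbb R^d\setminus\Omega)\times(\mathbb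 R^d\setminus\Omega))}\frac{|\tilde\chi_E(x)-\tilde\chi_E(y)|}{|x-y|^{d+\alpha}}\,dy\,dx\in[0,\infty],$$ and let $\operatorname{Per}_1(E;\Omega)=\operatorname{Per}(E;\Omega)=\sup\{\int_E\operatorname{div}T\,dx : T\in C^1_c(\Omega;\mathbb R^d),\ |T|\le1\}\in[0,\infty]$ be the classical perimeter. Write $\operatorname{Per}_\alpha(E)=\operatorname{Per}_\alpha(E;\mathbb R^d)$ and let $B_r$ be the open ball of radius $r$ centred at $0$. Claim. For each $\alpha\in(0,1]$ there is a constant $\delta>0$, depending only on $d,s,\alpha,\lambda,\Lambda$, such that for every $K\in\mathcal K$ and every Borel set $E\subset\mathbb R^d$ such that $\partial E$ has Lebesgue measure zero, $0\in\partial E$, and $H_{K,E}=0$ in $\mathbb R^d$ in the viscosity sense, $$\operatorname{Per}_\alpha(E;B_r)\ge\delta\,\operatorname{Per}_\alpha(B_r)\qquad\text{for all } r>0.$$ In particular, the lower surface density estimate holds: there is a constant $C>0$, depending only on $d,s,\lambda,\Lambda$, such that for all such $K$ and $E$, $$\operatorname{Per}(E;B_r)\ge C\,r^{d-1}\qquad\text{for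 all } r>0.$$ -/

import Mathlib

open MeasureTheory Filter Topology Set

noncomputable section

namespace NonlocalMinimal

/-- The kernels of order `s` on `ℝ^d`: measurable, symmetric, and comparable to `|y|^{-(d+s)}`
with ellipticity constants `lam`, `Lam`. The bounds are imposed away from the origin, where
`|y|^{-(d+s)}` is finite; the value of `K` at the origin plays no role. -/
structure IsEllipticKernel {d : ℕ} (s lam Lam : ℝ) (K : EuclideanSpace ℝ (Fin d) → ℝ) : Prop where
  aemeasurable : AEMeasurable K volume
  lower : ∀ y, y ≠ 0 → lam / ‖y‖ ^ ((d : ℝ) + s) ≤ K y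
  upper : ∀ y, y ≠ 0 → K y ≤ Lam / ‖y‖ ^ ((d : ℝ) + s)
  symm : ∀ y, K y = K (-y)

/-- The function `χ_{ℝ^d ∖ E} - χ_E`, equal to `-1` on `E` and to `1` off `E`. -/
def signedChar {d : ℕ} (E : Set (EuclideanSpace ℝ (Fin d))) (x : EuclideanSpace ℝ (Fin d)) : ℝ :=
  Eᶜ.indicator (fun _ => (1 : ℝ)) x - E.indicator (fun _ => (1 : ℝ)) x

/-- The integral of `(χ_{ℝ^d ∖ E} - χ_E)(y) K(x - y)` over `y ∈ ℝ^d ∖ B_ε(x)`. -/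
def truncatedCurvature {d : ℕ} (K : EuclideanSpace ℝ (Fin d) → ℝ)
    (E : Set (EuclideanSpace ℝ (Fin d))) (x : EuclideanSpace ℝ (Fin d)) (ε : ℝ) : ℝ :=
  ∫ y in (Metric.ball x ε)ᶜ, signedChar E y * K (x - y)

/-- The nonlocal mean curvature `H_{K,E}(x)`, the limit in `[-∞, +∞]` as `ε → 0+` of the truncated
integrals. The definitions below evaluate it only at boundary points with a touching ball, where
the limit exists for every elliptic kernel `K` of order `s ∈ (0,1)` and every Borel set `E`. -/
def nonlocalCurvature {d : ℕ} (K : EuclideanSpace ℝ (Fin d) → ℝ)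
    (E : Set (EuclideanSpace ℝ (Fin d))) (x : EuclideanSpace ℝ (Fin d)) : EReal :=
  limUnder (𝓝[>] (0 : ℝ)) (fun ε => ((truncatedCurvature K E x ε : ℝ) : EReal))

/-- There is an (open) ball of positive radius contained in `F` with `x` on its boundary. -/
def TouchedByBallIn {d : ℕ} (F : Set (EuclideanSpace ℝ (Fin d)))
    (x : EuclideanSpace ℝ (Fin d)) : Prop :=
  ∃ (x₀ : EuclideanSpace ℝ (Fin d)) (r : ℝ),
    0 < r ∧ Metric.ball x₀ r ⊆ F ∧ x ∈ Metric.sphere x₀ r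

/-- `H_{K,E} ≤ C₀` in `Ω` in the viscosity sense. -/
def ViscosityLE {d : ℕ} (K : EuclideanSpace ℝ (Fin d) → ℝ)
    (E Ω : Set (EuclideanSpace ℝ (Fin d))) (C₀ : ℝ) : Prop :=
  ∀ x ∈ frontier E ∩ Ω, TouchedByBallIn Eᶜ x → nonlocalCurvature K E x ≤ (C₀ : EReal)

/-- `H_{K,E} ≥ C₀` in `Ω` in the viscosity sense. -/
def ViscosityGE {d : ℕ} (K : EuclideanSpace ℝ (Fin d) → ℝ)
    (E Ω : Set (EuclideanSpace ℝ (Fin d))) (C₀ : ℝ) : Prop :=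
  ∀ x ∈ frontier E ∩ Ω, TouchedByBallIn E x → (C₀ : EReal) ≤ nonlocalCurvature K E x

/-- `H_{K,E} = C₀` in `Ω` in the viscosity sense. -/
def ViscosityEq {d : ℕ} (K : EuclideanSpace ℝ (Fin d) → ℝ)
    (E Ω : Set (EuclideanSpace ℝ (Fin d))) (C₀ : ℝ) : Prop :=
  ViscosityLE K E Ω C₀ ∧ ViscosityGE K E Ω C₀

/-- The nonlocal perimeter of `E` in `Ω` associated with the kernel `K`, with values in `[0, ∞]`:
one quarter of the integral of `|(χ_{Eᶜ} - χ_E)(x) - (χ_{Eᶜ} - χ_E)(y)| K(x - y)` over all pairs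
`(x, y)` that are not both outside of `Ω`. -/
def nonlocalPerimeter {d : ℕ} (K : EuclideanSpace ℝ (Fin d) → ℝ)
    (E Ω : Set (EuclideanSpace ℝ (Fin d))) : ENNReal :=
  4⁻¹ * ∫⁻ p in (Ωᶜ ×ˢ Ωᶜ)ᶜ, ENNReal.ofReal (|signedChar E p.1 - signedChar E p.2| * K (p.1 - p.2))

/-- The fractional perimeter of order `α ∈ (0,1)`, the case `K(y) = |y|^{-(d+α)}`. -/
def fractionalPerimeter {d : ℕ} (α : ℝ) (E Ω : Set (EuclideanSpace ℝ (Fin d))) : ENNReal :=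
  nonlocalPerimeter (fun y => 1 / ‖y‖ ^ ((d : ℝ) + α)) E Ω

/-- The divergence of a vector field on `ℝ^d`. -/
def divergence {d : ℕ} (T : EuclideanSpace ℝ (Fin d) → EuclideanSpace ℝ (Fin d))
    (x : EuclideanSpace ℝ (Fin d)) : ℝ :=
  ∑ i, (fderiv ℝ T x (EuclideanSpace.single i (1 : ℝ))) i

/-- The classical (De Giorgi) perimeter of `E` in the open set `Ω`, with values in `[0, ∞]`:
the supremum of `∫_E div T` over all `C¹` vector fields `T` with compact support in `Ω` and
`|T| ≤ 1`. -/
def classicalPerimeter {d : ℕ} (E Ω : Set (EuclideanSpace ℝ (Fin d))) : ENNReal :=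
  ⨆ (T : EuclideanSpace ℝ (Fin d) → EuclideanSpace ℝ (Fin d)) (_ : ContDiff ℝ 1 T)
    (_ : HasCompactSupport T) (_ : tsupport T ⊆ Ω) (_ : ∀ x, ‖T x‖ ≤ 1),
    ENNReal.ofReal (∫ x in E, divergence T x)

open Classical in
/-- `Per_α(E; Ω)` for `α ∈ (0,1]`: fractional if `α < 1`, classical if `α = 1`. -/
def perimeter {d : ℕ} (α : ℝ) (E Ω : Set (EuclideanSpace ℝ (Fin d))) : ENNReal :=
  if α = 1 then classicalPerimeter E Ω else fractionalPerimeter α E Ω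

end NonlocalMinimal

end

open MeasureTheory Filter Topology Set

noncomputable section

namespace NonlocalMinimal

/-! The proof has two halves: E and its complement each fill a fixed fraction of every B_r, and such
two-sided density bounds perimeter from below.

Density at touching points. Let a ball of radius ρ in the complement of F touch the frontier at x.
Symmetrize the curvature integrand under u ↦ -u. It can be negative only where both x + u and x - u
miss the touching ball, that is, outside two tangent balls. This set is so thin near 0 (volume of
order t^{d+1}/ρ in B_t) that, since s < 1, its kernel mass is at most a constant times ρ^{-s}
(`lintegral_cusp_le`). Nonpositive curvature then gives the positive part the same bound
(`exists_tendsto_truncatedCurvature`). If F were too sparse near x, then for most u with x + u in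
the touching ball also x - u ∉ F, and the positive part would be too large. Hence F has positive
density in B_ρ(x) (`le_volume_inter_ball_of_touching`).

Density at every scale. A point z near 0 outside the closure of F has a nearest point in the
frontier, touched by the ball about z of radius dist(z, F). A Vitali covering by such balls bounds
the volume of the complement near 0 by that of F in B_r, so F cannot be small there
(`le_volume_inter_ball_of_frontier`). The hypotheses are symmetric under complementation, which
gives the other phase (`exists_density_const`).

Perimeter. For α < 1, pairs in (E ∩ B_r) × (Eᶜ ∩ B_r) are at distance at most 2r, which gives order
r^{d-α}. For α = 1, a relative isoperimetric inequality (`volume_mul_volume_compl_le`), obtained by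
averaging a translation estimate, gives order r^{d-1}. Upper bounds of the same order for Per_α(B_r)
finish the proof. -/

/-- The Euclidean space `ℝ^d`. -/
abbrev Euc (d : ℕ) : Type := EuclideanSpace ℝ (Fin d)

/-! ### Ball volumes and layer-cake bounds for inverse powers of the norm. -/

/-- The volume of the unit ball of `ℝ^d`. -/
def ballVolume (d : ℕ) : ℝ := (volume (Metric.ball (0 : Euc d) 1)).toReal

theorem ballVolume_pos (d : ℕ) : 0 < ballVolume d :=
  ENNReal.toReal_pos (Metric.measure_ball_pos _ _ one_pos).ne' Metric.isBounded_ball.measure_lt_top.ne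

theorem volume_ball_eq {d : ℕ} (x : Euc d) {r : ℝ} (hr : 0 < r) :
    volume (Metric.ball x r) = ENNReal.ofReal (ballVolume d * r ^ d) := by
  rw [Measure.addHaar_ball_of_pos _ _ hr, finrank_euclideanSpace_fin, mul_comm (ballVolume d),
    ENNReal.ofReal_mul (by positivity), ballVolume,
    ENNReal.ofReal_toReal Metric.isBounded_ball.measure_lt_top.ne]

theorem volume_closedBall_eq {d : ℕ} (x : Euc d) {r : ℝ} (hr : 0 < r) :
    volume (Metric.closedBall x r) = ENNReal.ofReal (ballVolume d * r ^ d) := by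
  rw [Measure.addHaar_closedBall _ _ hr.le, ← Measure.addHaar_ball_of_pos _ x hr,
    volume_ball_eq x hr]

/-- Pointwise layer-cake representation of `‖y‖^{-p}`, as an inequality valid also at `0`. -/
theorem ofReal_one_div_norm_rpow_le {d : ℕ} {p : ℝ} (hp : 0 < p) (y : Euc d) :
    ENNReal.ofReal (1 / ‖y‖ ^ p) ≤
      ∫⁻ t in Ioi ‖y‖, ENNReal.ofReal (p * t ^ (-p - 1)) := by
  rcases eq_or_ne y 0 with rfl | hy
  -- At the origin the left side is `1 / 0 = 0` by convention.
  · simp [Real.zero_rpow hp.ne']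
  have hy' : 0 < ‖y‖ := norm_pos_iff.2 hy
  rw [← ofReal_integral_eq_lintegral_ofReal]
  · rw [integral_const_mul, integral_Ioi_rpow_of_lt (by linarith) hy']
    apply le_of_eq
    congr 1
    rw [show -p - 1 + 1 = -p by ring, Real.rpow_neg hy'.le]
    field_simp
  · exact (integrableOn_Ioi_rpow_of_lt (by linarith) hy').const_mul _
  · filter_upwards [self_mem_ae_restrict measurableSet_Ioi] with t ht
    have : 0 < t := hy'.trans ht
    positivity

/-- Integrating the pointwise layer-cake bound and exchanging integrals turns kernel mass into
volumes in balls, the only information about a set used later. -/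
theorem lintegral_one_div_norm_rpow_le {d : ℕ} {p : ℝ} (hp : 0 < p) (S : Set (Euc d)) :
    ∫⁻ y in S, ENNReal.ofReal (1 / ‖y‖ ^ p) ≤
      ∫⁻ t in Ioi (0 : ℝ), ENNReal.ofReal (p * t ^ (-p - 1)) * volume (S ∩ Metric.ball 0 t) := by
  set w : ℝ → ENNReal := fun t => ENNReal.ofReal (p * t ^ (-p - 1)) with hw
  have hwm : Measurable w := by fun_prop
  have hind : Measurable (fun q : Euc d × ℝ => ({q | ‖q.1‖ < q.2} : Set (Euc d × ℝ)).indicator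
      (fun q => w q.2) q) :=
    (hwm.comp measurable_snd).indicator (measurableSet_lt (by fun_prop) (by fun_prop))
  calc ∫⁻ y in S, ENNReal.ofReal (1 / ‖y‖ ^ p)
      ≤ ∫⁻ y in S, ∫⁻ t in Ioi (0 : ℝ), ({q : Euc d × ℝ | ‖q.1‖ < q.2}).indicator
          (fun q => w q.2) (y, t) := by
        refine lintegral_mono fun y => (ofReal_one_div_norm_rpow_le hp y).trans ?_
        rw [← lintegral_indicator measurableSet_Ioi, ← lintegral_indicator measurableSet_Ioi]
        refine lintegral_mono fun t => ?_
        by_cases h : ‖y‖ < t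
        · have h0 : 0 < t := (norm_nonneg y).trans_lt h
          simp [indicator, h, h0, hw]
        · simp [indicator, h]
    _ = ∫⁻ t in Ioi (0 : ℝ), ∫⁻ y in S, ({q : Euc d × ℝ | ‖q.1‖ < q.2}).indicator
          (fun q => w q.2) (y, t) := lintegral_lintegral_swap hind.aemeasurable
    _ = _ := by
        refine lintegral_congr fun t => ?_
        have : ∀ y : Euc d, ({q : Euc d × ℝ | ‖q.1‖ < q.2}).indicator (fun q => w q.2) (y, t)
            = (Metric.ball (0 : Euc d) t).indicator (fun _ => w t) y := by
          intro y; simp [indicator]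
        simp only [this]
        rw [lintegral_indicator_const Metric.isOpen_ball.measurableSet,
          Measure.restrict_apply Metric.isOpen_ball.measurableSet, inter_comm]

theorem lintegral_Ioi_mul_rpow {p R : ℝ} (hp : 0 < p) (hR : 0 < R) {A : ℝ} (hA : 0 ≤ A) :
    ∫⁻ t in Ioi R, ENNReal.ofReal (A * t ^ (-p - 1)) = ENNReal.ofReal (A / p * R ^ (-p)) := by
  rw [← ofReal_integral_eq_lintegral_ofReal]
  · rw [integral_const_mul, integral_Ioi_rpow_of_lt (by linarith) hR]
    congr 1
    rw [show -p - 1 + 1 = -p by ring]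
    field_simp
  · exact (integrableOn_Ioi_rpow_of_lt (by linarith) hR).const_mul _
  · filter_upwards [self_mem_ae_restrict measurableSet_Ioi] with t ht
    have : 0 < t := hR.trans ht
    positivity

theorem lintegral_Ioc_mul_rpow {p R : ℝ} (hp : 0 < p) (hR : 0 < R) {A : ℝ} (hA : 0 ≤ A) :
    ∫⁻ t in Ioc 0 R, ENNReal.ofReal (A * t ^ (p - 1)) = ENNReal.ofReal (A / p * R ^ p) := by
  have hi : IntervalIntegrable (fun t : ℝ => A * t ^ (p - 1)) volume 0 R :=
    (intervalIntegral.intervalIntegrable_rpow' (by linarith)).const_mul _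
  rw [← ofReal_integral_eq_lintegral_ofReal]
  · rw [← intervalIntegral.integral_of_le hR.le, intervalIntegral.integral_const_mul,
      integral_rpow (Or.inl (by linarith))]
    congr 1
    rw [show p - 1 + 1 = p by ring, Real.zero_rpow hp.ne']
    field_simp
    ring
  · exact (intervalIntegrable_iff_integrableOn_Ioc_of_le hR.le).1 hi
  · filter_upwards [self_mem_ae_restrict measurableSet_Ioc] with t ht
    have : 0 < t := ht.1
    positivity

/-- A set whose intersections with small balls decay like `t^q` has finite `‖y‖^{-p}`-mass for
`p < q`. -/
theorem lintegral_one_div_norm_rpow_le_of_decay {d : ℕ} {p q A R : ℝ} (hp : 0 < p) (hpq : p < q)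
    (hA : 0 ≤ A) (hR : 0 < R) {S : Set (Euc d)}
    (hSR : S ⊆ Metric.ball 0 R)
    (hdecay : ∀ t ∈ Ioc 0 R, volume (S ∩ Metric.ball 0 t) ≤ ENNReal.ofReal (A * t ^ q)) :
    ∫⁻ y in S, ENNReal.ofReal (1 / ‖y‖ ^ p) ≤
      ENNReal.ofReal (A * (p / (q - p) + 1) * R ^ (q - p)) := by
  have hqp : 0 < q - p := sub_pos.2 hpq
  refine (lintegral_one_div_norm_rpow_le hp S).trans ?_
  rw [← Ioc_union_Ioi_eq_Ioi hR.le]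
  refine (lintegral_union_le _ _ _).trans ?_
  have h1 : ∫⁻ t in Ioc 0 R, ENNReal.ofReal (p * t ^ (-p - 1)) * volume (S ∩ Metric.ball 0 t)
      ≤ ENNReal.ofReal (p * A / (q - p) * R ^ (q - p)) := by
    rw [← lintegral_Ioc_mul_rpow hqp hR (by positivity)]
    refine setLIntegral_mono' measurableSet_Ioc fun t ht => ?_
    have h0 : 0 < t := ht.1
    refine (mul_le_mul_right (hdecay t ht) _).trans ?_
    rw [← ENNReal.ofReal_mul (by positivity)]
    apply le_of_eq
    congr 1
    rw [show q - p - 1 = (-p - 1) + q by ring, Real.rpow_add h0]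
    ring
  have h2 : ∫⁻ t in Ioi R, ENNReal.ofReal (p * t ^ (-p - 1)) * volume (S ∩ Metric.ball 0 t)
      ≤ ENNReal.ofReal (A * R ^ (q - p)) := by
    -- Beyond radius R the intersection stops growing, so the bound at t = R serves for all larger
    -- t.
    have hS' : volume S ≤ ENNReal.ofReal (A * R ^ q) := by
      simpa [inter_eq_left.2 hSR] using hdecay R ⟨hR, le_rfl⟩
    calc _ ≤ ∫⁻ t in Ioi R, ENNReal.ofReal (p * t ^ (-p - 1)) * ENNReal.ofReal (A * R ^ q) :=
          lintegral_mono fun t => mul_le_mul_right ((measure_mono inter_subset_left).trans hS') _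
      _ = ENNReal.ofReal (p / p * R ^ (-p)) * ENNReal.ofReal (A * R ^ q) := by
          rw [lintegral_mul_const _ (by fun_prop), lintegral_Ioi_mul_rpow hp hR hp.le]
      _ ≤ _ := by
          rw [← ENNReal.ofReal_mul (by positivity)]
          apply le_of_eq
          congr 1
          rw [sub_eq_add_neg, Real.rpow_add hR]
          field_simp
  refine (add_le_add h1 h2).trans ?_
  rw [← ENNReal.ofReal_add (by positivity) (by positivity)]
  apply le_of_eq
  congr 1
  ring

/-- In the layer-cake formula, levels t ≤ R contribute nothing and levels t > R at most the volume
of the full ball, leaving an integrable tail t^{-s-1}. -/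
theorem lintegral_compl_ball_one_div_norm_rpow_le {d : ℕ} {s R : ℝ} (hs : 0 < s) (hR : 0 < R) :
    ∫⁻ y in (Metric.ball (0 : Euc d) R)ᶜ, ENNReal.ofReal (1 / ‖y‖ ^ ((d : ℝ) + s)) ≤
      ENNReal.ofReal (ballVolume d * ((d + s) / s) * R ^ (-s)) := by
  have hω := ballVolume_pos d
  have hp : 0 < (d : ℝ) + s := by positivity
  refine (lintegral_one_div_norm_rpow_le hp _).trans ?_
  calc _ ≤ ∫⁻ t in Ioi (0 : ℝ), (Ioi R).indicator
        (fun t => ENNReal.ofReal ((d + s) * ballVolume d * t ^ (-s - 1))) t := by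
        refine setLIntegral_mono' measurableSet_Ioi fun t ht => ?_
        have h0 : 0 < t := ht
        by_cases h : R < t
        · rw [indicator_of_mem (by exact h)]
          refine (mul_le_mul_right ((measure_mono inter_subset_right).trans
            (volume_ball_eq 0 h0).le) _).trans ?_
          rw [← ENNReal.ofReal_mul (by positivity)]
          apply le_of_eq
          congr 1
          rw [show -s - 1 = (-(d + s) - 1) + (d : ℝ) by ring, Real.rpow_add h0, Real.rpow_natCast]
          ring
        · have : (Metric.ball (0 : Euc d) R)ᶜ ∩ Metric.ball 0 t = ∅ := by
            ext y; simp; intro _; linarith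
          simp [this]
    _ ≤ ∫⁻ t in Ioi R, ENNReal.ofReal ((d + s) * ballVolume d * t ^ (-s - 1)) := by
        rw [← lintegral_indicator measurableSet_Ioi]
        rw [← lintegral_indicator measurableSet_Ioi]
        exact lintegral_mono fun t => indicator_le_self _ _ _
    _ ≤ _ := by
        rw [lintegral_Ioi_mul_rpow hs hR (by positivity)]
        apply le_of_eq
        congr 1
        ring

/-! ### Kernel mass outside two tangent balls. -/

/-- A slab of half-width `a` meets the ball of radius `t` in volume at most `C a t^{d-1}`. -/
theorem volume_slab_inter_ball_le {d : ℕ} {e : Euc d} (he : ‖e‖ = 1) {a t : ℝ} (ha : 0 ≤ a)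
    (ht : 0 < t) :
    volume {y : Euc d | ‖y‖ < t ∧ |inner ℝ y e| ≤ a} ≤
      ENNReal.ofReal (2 * a * (ballVolume d * 2 ^ d) * t ^ ((d : ℝ) - 1)) := by
  have hω := ballVolume_pos d
  set S : Set (Euc d) := {y | ‖y‖ < t ∧ |inner ℝ y e| ≤ a} with hSdef
  have hS : MeasurableSet S :=
    (measurableSet_lt (f := fun y : Euc d => ‖y‖) (by fun_prop) (by fun_prop)).inter
      (measurableSet_le (f := fun y : Euc d => |inner ℝ y e|) (by fun_prop) (by fun_prop))
  have hm : Measurable (fun q : ℝ × Euc d => S.indicator (fun _ => (1 : ENNReal)) (q.2 - q.1 • e)) :=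
    (measurable_const.indicator hS).comp (by fun_prop)
  -- Average over the translates S + τe with 0 ≤ τ ≤ t: they all lie in B_{2t}, and each point
  -- belongs to them only for τ in an interval of length 2a.
  have key : ENNReal.ofReal t * volume S ≤
      ENNReal.ofReal (2 * a) * volume (Metric.ball (0 : Euc d) (2 * t)) := by
    calc ENNReal.ofReal t * volume S
        = ∫⁻ τ in Icc 0 t, ∫⁻ y : Euc d, S.indicator (fun _ => 1) (y - τ • e) := by
          have : ∀ τ : ℝ, ∫⁻ y : Euc d, S.indicator (fun _ => (1 : ENNReal)) (y - τ • e)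
              = volume S := fun τ => by
            rw [lintegral_sub_right_eq_self (fun y => S.indicator (fun _ => (1 : ENNReal)) y),
              lintegral_indicator_const hS, one_mul]
          simp [this, mul_comm]
      _ = ∫⁻ y : Euc d, ∫⁻ τ in Icc 0 t, S.indicator (fun _ => 1) (y - τ • e) :=
          lintegral_lintegral_swap hm.aemeasurable
      _ ≤ ∫⁻ y : Euc d, (Metric.ball (0 : Euc d) (2 * t)).indicator
            (fun _ => ENNReal.ofReal (2 * a)) y := by
          refine lintegral_mono fun y => ?_
          by_cases hy : ‖y‖ < 2 * t
          · rw [indicator_of_mem (by simpa using hy)]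
            calc ∫⁻ τ in Icc 0 t, S.indicator (fun _ => (1 : ENNReal)) (y - τ • e)
                ≤ ∫⁻ τ, (Icc (inner ℝ y e - a) (inner ℝ y e + a)).indicator
                    (fun _ => (1 : ENNReal)) τ := by
                  refine (setLIntegral_le_lintegral _ _).trans (lintegral_mono fun τ => ?_)
                  by_cases hτ : y - τ • e ∈ S
                  · have h2 := hτ.2
                    rw [inner_sub_left, real_inner_smul_left, real_inner_self_eq_norm_sq, he,
                      abs_le] at h2
                    rw [indicator_of_mem hτ, indicator_of_mem (by constructor <;> linarith)]
                  · rw [indicator_of_notMem hτ]; exact zero_le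
              _ = ENNReal.ofReal (2 * a) := by
                  rw [lintegral_indicator_const measurableSet_Icc, one_mul, Real.volume_Icc]
                  congr 1; ring
          · rw [indicator_of_notMem (by simpa using hy)]
            refine (setLIntegral_congr_fun measurableSet_Icc fun τ hτ => ?_).trans_le
              (by rw [lintegral_zero])
            refine indicator_of_notMem (fun h => hy ?_) _
            have h1 : ‖y - τ • e‖ < t := h.1
            have h2 : ‖τ • e‖ ≤ t := by
              rw [norm_smul, he, mul_one, Real.norm_of_nonneg hτ.1]; exact hτ.2
            calc ‖y‖ = ‖(y - τ • e) + τ • e‖ := by rw [sub_add_cancel]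
              _ ≤ _ := norm_add_le _ _
              _ < 2 * t := by linarith
      _ = _ := by rw [lintegral_indicator_const Metric.isOpen_ball.measurableSet]
  rw [volume_ball_eq _ (by positivity), ← ENNReal.ofReal_mul (by positivity)] at key
  rw [← ENNReal.mul_le_mul_iff_right (a := ENNReal.ofReal t) (by simpa using ht)
    ENNReal.ofReal_ne_top]
  refine key.trans ?_
  rw [← ENNReal.ofReal_mul ht.le]
  apply le_of_eq
  congr 1
  rw [Real.rpow_sub_one ht.ne', Real.rpow_natCast, mul_pow]
  field_simp

theorem not_mem_ball_iff_inner_le {d : ℕ} {v y : Euc d} {ρ : ℝ} (hv : ‖v‖ = ρ) :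
    y ∉ Metric.ball v ρ ↔ 2 * inner ℝ y v ≤ ‖y‖ ^ 2 := by
  have hρ : 0 ≤ ρ := hv ▸ norm_nonneg v
  rw [Metric.mem_ball, dist_eq_norm, not_lt, ← sq_le_sq₀ hρ (norm_nonneg _), norm_sub_sq_real, hv]
  constructor <;> intro h <;> linarith

/-- The constant bounding the mass of `‖y‖^{-(d+s)}` outside of two tangent unit balls. -/
def cuspConst (d : ℕ) (s : ℝ) : ℝ :=
  ballVolume d * 2 ^ d * ((d + s) / (1 - s) + 1) + ballVolume d * ((d + s) / s)

theorem cuspConst_pos (d : ℕ) {s : ℝ} (hs : s ∈ Ioo (0 : ℝ) 1) : 0 < cuspConst d s := by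
  have h1 : 0 < 1 - s := sub_pos.2 hs.2
  have h0 := hs.1
  have hω := ballVolume_pos d
  unfold cuspConst
  positivity

/-- Missing both tangent balls means |⟨y, v⟩| ≤ |y|²/2, so inside B_t the set lies in a slab of
half-width t²/(2ρ) and has volume of order t^{d+1}/ρ. The decay exponent d + 1 exceeds d + s, so the
singularity is integrable; outside B_ρ the tail bound suffices. -/
theorem lintegral_cusp_le {d : ℕ} {s ρ : ℝ} (hs : s ∈ Ioo (0 : ℝ) 1) (hρ : 0 < ρ) {v : Euc d}
    (hv : ‖v‖ = ρ) :
    ∫⁻ y in {y : Euc d | y ∉ Metric.ball v ρ ∧ -y ∉ Metric.ball v ρ},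
        ENNReal.ofReal (1 / ‖y‖ ^ ((d : ℝ) + s)) ≤
      ENNReal.ofReal (cuspConst d s * ρ ^ (-s)) := by
  have h1 : 0 < 1 - s := sub_pos.2 hs.2
  have h0 := hs.1
  have hω := ballVolume_pos d
  set G : Set (Euc d) := {y | y ∉ Metric.ball v ρ ∧ -y ∉ Metric.ball v ρ} with hGdef
  have hin : ∫⁻ y in G ∩ Metric.ball 0 ρ, ENNReal.ofReal (1 / ‖y‖ ^ ((d : ℝ) + s)) ≤
      ENNReal.ofReal (ballVolume d * 2 ^ d / ρ * ((d + s) / ((d : ℝ) + 1 - (d + s)) + 1) *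
        ρ ^ ((d : ℝ) + 1 - (d + s))) := by
    refine lintegral_one_div_norm_rpow_le_of_decay (by positivity) (by linarith) (by positivity) hρ
      inter_subset_right fun t ht => ?_
    have ht0 : 0 < t := ht.1
    have he : ‖ρ⁻¹ • v‖ = 1 := by
      rw [norm_smul, hv, norm_inv, Real.norm_of_nonneg hρ.le, inv_mul_cancel₀ hρ.ne']
    refine (measure_mono ?_).trans ((volume_slab_inter_ball_le he (a := t ^ 2 / (2 * ρ))
      (by positivity) ht0).trans (le_of_eq ?_))
    · rintro y ⟨⟨⟨hy1, hy2⟩, -⟩, hy3⟩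
      rw [not_mem_ball_iff_inner_le hv] at hy1 hy2
      rw [inner_neg_left, norm_neg] at hy2
      have hy4 : ‖y‖ < t := by simpa using hy3
      have hy5 : ‖y‖ ^ 2 ≤ t ^ 2 := by gcongr
      refine ⟨hy4, ?_⟩
      rw [real_inner_smul_right, abs_mul, abs_of_pos (inv_pos.2 hρ)]
      have : |inner ℝ y v| ≤ t ^ 2 / 2 := abs_le.2 ⟨by linarith, by linarith⟩
      calc ρ⁻¹ * |inner ℝ y v| ≤ ρ⁻¹ * (t ^ 2 / 2) := by gcongr
        _ = t ^ 2 / (2 * ρ) := by field_simp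
    · congr 1
      rw [Real.rpow_add_one ht0.ne', Real.rpow_sub_one ht0.ne']
      field_simp
  have hsub : G ⊆ (G ∩ Metric.ball 0 ρ) ∪ (Metric.ball 0 ρ)ᶜ := fun y hy => by
    by_cases h : y ∈ Metric.ball (0 : Euc d) ρ
    · exact Or.inl ⟨hy, h⟩
    · exact Or.inr h
  refine (lintegral_mono_set hsub).trans ((lintegral_union_le _ _ _).trans ?_)
  refine (add_le_add hin (lintegral_compl_ball_one_div_norm_rpow_le h0 hρ)).trans ?_
  have e1 : (d : ℝ) + 1 - (d + s) = 1 - s := by ring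
  rw [e1, ← ENNReal.ofReal_add (by positivity) (by positivity)]
  apply le_of_eq
  congr 1
  rw [sub_eq_add_neg, Real.rpow_add hρ, Real.rpow_one, ← sub_eq_add_neg, cuspConst]
  field_simp

/-! ### The symmetrized curvature integrand and existence of the curvature. -/

theorem signedChar_of_mem {d : ℕ} {F : Set (Euc d)} {y : Euc d} (h : y ∈ F) :
    signedChar F y = -1 := by
  simp [signedChar, h]

theorem signedChar_of_notMem {d : ℕ} {F : Set (Euc d)} {y : Euc d} (h : y ∉ F) :
    signedChar F y = 1 := by
  simp [signedChar, h]

theorem signedChar_compl {d : ℕ} (F : Set (Euc d)) (y : Euc d) :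
    signedChar Fᶜ y = -signedChar F y := by
  by_cases h : y ∈ F
  · rw [signedChar_of_mem h, signedChar_of_notMem (by simpa using h), neg_neg]
  · rw [signedChar_of_notMem h, signedChar_of_mem (by simpa using h)]

theorem abs_signedChar {d : ℕ} (F : Set (Euc d)) (y : Euc d) : |signedChar F y| = 1 := by
  by_cases h : y ∈ F
  · simp [signedChar_of_mem h]
  · simp [signedChar_of_notMem h]

theorem measurable_signedChar {d : ℕ} {F : Set (Euc d)} (hF : MeasurableSet F) :
    Measurable (signedChar F) :=
  (measurable_const.indicator hF.compl).sub (measurable_const.indicator hF)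

/-- The curvature integrand in direction `u`, symmetrized under `u ↦ -u`. -/
def symmIntegrand {d : ℕ} (K : Euc d → ℝ) (F : Set (Euc d)) (x u : Euc d) : ℝ :=
  2⁻¹ * (signedChar F (x + u) + signedChar F (x - u)) * K u

namespace IsEllipticKernel

variable {d : ℕ} {s lam Lam : ℝ} {K : Euc d → ℝ}

theorem nonneg (hK : IsEllipticKernel s lam Lam K) (hlam : 0 < lam) {u : Euc d} (hu : u ≠ 0) :
    0 ≤ K u :=
  le_trans (by positivity) (hK.lower u hu)

theorem ofReal_le (hK : IsEllipticKernel s lam Lam K) (hLam : 0 ≤ Lam) {u : Euc d} (hu : u ≠ 0) :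
    ENNReal.ofReal (K u) ≤ ENNReal.ofReal Lam * ENNReal.ofReal (1 / ‖u‖ ^ ((d : ℝ) + s)) := by
  rw [← ENNReal.ofReal_mul hLam, mul_one_div]
  exact ENNReal.ofReal_le_ofReal (hK.upper u hu)

theorem lintegral_compl_ball_lt_top (hK : IsEllipticKernel s lam Lam K) (hs : 0 < s)
    (hLam : 0 ≤ Lam) {ε : ℝ} (hε : 0 < ε) :
    ∫⁻ u in (Metric.ball (0 : Euc d) ε)ᶜ, ENNReal.ofReal (K u) < ⊤ := by
  calc _ ≤ ∫⁻ u in (Metric.ball (0 : Euc d) ε)ᶜ,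
        ENNReal.ofReal Lam * ENNReal.ofReal (1 / ‖u‖ ^ ((d : ℝ) + s)) := by
        refine setLIntegral_mono' Metric.isOpen_ball.measurableSet.compl fun u hu => ?_
        refine hK.ofReal_le hLam ?_
        rintro rfl
        simp [hε] at hu
    _ < ⊤ := by
        rw [lintegral_const_mul' _ _ ENNReal.ofReal_ne_top]
        exact ENNReal.mul_lt_top ENNReal.ofReal_lt_top
          ((lintegral_compl_ball_one_div_norm_rpow_le hs hε).trans_lt ENNReal.ofReal_lt_top)

theorem integrableOn_compl_ball (hK : IsEllipticKernel s lam Lam K) (hs : 0 < s) (hlam : 0 < lam)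
    (hLam : 0 ≤ Lam) {ε : ℝ} (hε : 0 < ε) : IntegrableOn K (Metric.ball (0 : Euc d) ε)ᶜ := by
  refine ⟨hK.aemeasurable.aestronglyMeasurable.restrict, ?_⟩
  refine lt_of_le_of_lt ?_ (hK.lintegral_compl_ball_lt_top hs hLam hε)
  refine setLIntegral_mono' Metric.isOpen_ball.measurableSet.compl fun u hu => ?_
  have : u ≠ 0 := by
    rintro rfl
    simp [hε] at hu
  rw [Real.enorm_of_nonneg (hK.nonneg hlam this)]

theorem integrableOn_mul (hK : IsEllipticKernel s lam Lam K) (hs : 0 < s) (hlam : 0 < lam)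
    (hLam : 0 ≤ Lam) {ε : ℝ} (hε : 0 < ε) {f : Euc d → ℝ} (hf : Measurable f)
    (hf1 : ∀ u, |f u| ≤ 1) : IntegrableOn (fun u => f u * K u) (Metric.ball (0 : Euc d) ε)ᶜ :=
  (hK.integrableOn_compl_ball hs hlam hLam hε).bdd_mul (c := 1) hf.aestronglyMeasurable.restrict
    (ae_of_all _ hf1)

/-- Substitute y = x + u and y = x - u, use that K is even, and average the two expressions. -/
theorem truncatedCurvature_eq (hK : IsEllipticKernel s lam Lam K) (hs : 0 < s) (hlam : 0 < lam)
    (hLam : 0 ≤ Lam) {F : Set (Euc d)} (hF : MeasurableSet F) (x : Euc d) {ε : ℝ} (hε : 0 < ε) :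
    truncatedCurvature K F x ε = ∫ u in (Metric.ball (0 : Euc d) ε)ᶜ, symmIntegrand K F x u := by
  have hm := measurable_signedChar hF
  have h1 : truncatedCurvature K F x ε =
      ∫ u in (Metric.ball (0 : Euc d) ε)ᶜ, signedChar F (x + u) * K u := by
    have := (measurePreserving_add_left volume x).setIntegral_preimage_emb
      (measurableEmbedding_addLeft x) (fun y => signedChar F y * K (x - y)) (Metric.ball x ε)ᶜ
    rw [truncatedCurvature, ← this]
    have e : (fun u => x + u) ⁻¹' (Metric.ball x ε)ᶜ = (Metric.ball (0 : Euc d) ε)ᶜ := by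
      ext u; simp
    rw [e]
    refine integral_congr_ae (ae_of_all _ fun u => ?_)
    simp only [sub_add_cancel_left]
    rw [← hK.symm]
  have h2 : truncatedCurvature K F x ε =
      ∫ u in (Metric.ball (0 : Euc d) ε)ᶜ, signedChar F (x - u) * K u := by
    have := (Measure.measurePreserving_sub_left volume x).setIntegral_preimage_emb
      (MeasurableEquiv.subLeft x).measurableEmbedding
      (fun y => signedChar F y * K (x - y)) (Metric.ball x ε)ᶜ
    rw [truncatedCurvature, ← this]
    have e : (fun u => x - u) ⁻¹' (Metric.ball x ε)ᶜ = (Metric.ball (0 : Euc d) ε)ᶜ := by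
      ext u; simp [dist_eq_norm]
    rw [e]
    refine integral_congr_ae (ae_of_all _ fun u => ?_)
    simp only [sub_sub_cancel]
  have i1 := hK.integrableOn_mul hs hlam hLam hε (f := fun u => signedChar F (x + u))
    (hm.comp (by fun_prop)) (fun u => (abs_signedChar _ _).le)
  have i2 := hK.integrableOn_mul hs hlam hLam hε (f := fun u => signedChar F (x - u))
    (hm.comp (by fun_prop)) (fun u => (abs_signedChar _ _).le)
  have : truncatedCurvature K F x ε =
      2⁻¹ * (truncatedCurvature K F x ε + truncatedCurvature K F x ε) := by ring
  rw [this]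
  nth_rewrite 1 [h1]
  rw [h2, ← integral_add i1 i2, ← integral_const_mul]
  refine integral_congr_ae (ae_of_all _ fun u => ?_)
  simp only [symmIntegrand]
  ring

theorem integrableOn_symmIntegrand (hK : IsEllipticKernel s lam Lam K) (hs : 0 < s)
    (hlam : 0 < lam) (hLam : 0 ≤ Lam) {F : Set (Euc d)} (hF : MeasurableSet F) (x : Euc d) {ε : ℝ}
    (hε : 0 < ε) : IntegrableOn (symmIntegrand K F x) (Metric.ball (0 : Euc d) ε)ᶜ := by
  have hm := measurable_signedChar hF
  refine hK.integrableOn_mul hs hlam hLam hε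
    (f := fun u => 2⁻¹ * (signedChar F (x + u) + signedChar F (x - u))) ?_ fun u => ?_
  · exact ((hm.comp (by fun_prop)).add (hm.comp (by fun_prop))).const_mul _
  · have h1 := abs_le.1 (abs_signedChar F (x + u)).le
    have h2 := abs_le.1 (abs_signedChar F (x - u)).le
    rw [abs_le]
    constructor <;> linarith [h1.1, h1.2, h2.1, h2.2]

/-- At a point touched by a ball in the complement, the negative part of the symmetrized integrand
lives outside of two tangent balls. -/
theorem lintegral_neg_symmIntegrand_le (hK : IsEllipticKernel s lam Lam K) (hs : s ∈ Ioo (0 : ℝ) 1)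
    (hlam : 0 < lam) (hLam : 0 ≤ Lam) {F : Set (Euc d)} {x z : Euc d} {ρ : ℝ} (hρ : 0 < ρ)
    (hball : Metric.ball z ρ ⊆ Fᶜ) (hx : x ∈ Metric.sphere z ρ) {ε : ℝ} (hε : 0 < ε) :
    ∫⁻ u in (Metric.ball (0 : Euc d) ε)ᶜ, ENNReal.ofReal (-symmIntegrand K F x u) ≤
      ENNReal.ofReal (Lam * cuspConst d s * ρ ^ (-s)) := by
  have hv : ‖z - x‖ = ρ := by rw [← dist_eq_norm, dist_comm]; exact hx
  set G : Set (Euc d) := {y | y ∉ Metric.ball (z - x) ρ ∧ -y ∉ Metric.ball (z - x) ρ} with hGdef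
  have hG : MeasurableSet G :=
    Metric.isOpen_ball.measurableSet.compl.inter
      (measurable_neg Metric.isOpen_ball.measurableSet.compl)
  calc _ ≤ ∫⁻ u in (Metric.ball (0 : Euc d) ε)ᶜ, G.indicator
        (fun u => ENNReal.ofReal Lam * ENNReal.ofReal (1 / ‖u‖ ^ ((d : ℝ) + s))) u := by
        refine setLIntegral_mono' Metric.isOpen_ball.measurableSet.compl fun u hu => ?_
        have hu0 : u ≠ 0 := by
          rintro rfl
          simp [hε] at hu
        have hKu := hK.nonneg hlam hu0
        have h1 := abs_le.1 (abs_signedChar F (x + u)).le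
        have h2 := abs_le.1 (abs_signedChar F (x - u)).le
        by_cases huG : u ∈ G
        · rw [indicator_of_mem huG]
          refine (ENNReal.ofReal_le_ofReal ?_).trans (hK.ofReal_le hLam hu0)
          rw [symmIntegrand, ← neg_mul]
          refine mul_le_of_le_one_left hKu ?_
          linarith [h1.1, h2.1]
        -- Off G one of x ± u lies in the touching ball, where the sign is +1; the other sign is at
        -- least -1, so the sum is nonnegative.
        · rw [indicator_of_notMem huG, nonpos_iff_eq_zero, ENNReal.ofReal_eq_zero, neg_nonpos]
          refine mul_nonneg (mul_nonneg (by norm_num) ?_) hKu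
          rw [hGdef, mem_ofPred_eq, not_and_or, not_not, not_not] at huG
          rcases huG with h | h
          · have : x + u ∉ F := hball (by
              rw [Metric.mem_ball, dist_eq_norm] at h ⊢
              rwa [show x + u - z = u - (z - x) by abel])
            rw [signedChar_of_notMem this]
            linarith [h2.1]
          · have : x - u ∉ F := hball (by
              rw [Metric.mem_ball, dist_eq_norm] at h ⊢
              rwa [show x - u - z = -u - (z - x) by abel])
            rw [signedChar_of_notMem this]
            linarith [h1.1]
    _ ≤ ENNReal.ofReal Lam * ∫⁻ u in G, ENNReal.ofReal (1 / ‖u‖ ^ ((d : ℝ) + s)) := by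
        rw [← lintegral_const_mul' _ _ ENNReal.ofReal_ne_top, ← lintegral_indicator hG]
        exact setLIntegral_le_lintegral _ _
    _ ≤ _ := by
        refine (mul_le_mul_right (lintegral_cusp_le hs hρ hv) _).trans ?_
        rw [← ENNReal.ofReal_mul hLam, mul_assoc]

end IsEllipticKernel

namespace IsEllipticKernel

variable {d : ℕ} {s lam Lam : ℝ} {K : Euc d → ℝ}

/-- The nonlocal curvature exists at a point touched by a ball in the complement; if it is
nonpositive, then the positive part of the symmetrized integrand has controlled mass. -/
theorem exists_tendsto_truncatedCurvature (hK : IsEllipticKernel s lam Lam K)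
    (hs : s ∈ Ioo (0 : ℝ) 1) (hlam : 0 < lam) (hLam : 0 ≤ Lam) {F : Set (Euc d)}
    (hF : MeasurableSet F) {x z : Euc d} {ρ : ℝ} (hρ : 0 < ρ) (hball : Metric.ball z ρ ⊆ Fᶜ)
    (hx : x ∈ Metric.sphere z ρ) :
    ∃ L : EReal, Tendsto (fun ε => ((truncatedCurvature K F x ε : ℝ) : EReal)) (𝓝[>] 0) (𝓝 L) ∧
      (L ≤ 0 → ∀ ε > 0,
        ∫⁻ u in (Metric.ball (0 : Euc d) ε)ᶜ, ENNReal.ofReal (symmIntegrand K F x u) ≤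
          ENNReal.ofReal (Lam * cuspConst d s * ρ ^ (-s))) := by
  set A : ℝ → ENNReal := fun ε =>
    ∫⁻ u in (Metric.ball (0 : Euc d) ε)ᶜ, ENNReal.ofReal (symmIntegrand K F x u) with hA
  set B : ℝ → ENNReal := fun ε =>
    ∫⁻ u in (Metric.ball (0 : Euc d) ε)ᶜ, ENNReal.ofReal (-symmIntegrand K F x u) with hB
  set M : ENNReal := ENNReal.ofReal (Lam * cuspConst d s * ρ ^ (-s)) with hM
  have hBM : ∀ ε > 0, B ε ≤ M := fun ε hε =>
    hK.lintegral_neg_symmIntegrand_le hs hlam hLam hρ hball hx hε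
  -- Both masses increase as ε decreases, so each has a one-sided limit; the negative one is finite,
  -- so the difference makes sense in `EReal`.
  have hAanti : Antitone A := fun a b hab =>
    lintegral_mono_set (compl_subset_compl.2 (Metric.ball_subset_ball hab))
  have hBanti : Antitone B := fun a b hab =>
    lintegral_mono_set (compl_subset_compl.2 (Metric.ball_subset_ball hab))
  have hAlim := hAanti.tendsto_nhdsGT 0
  have hBlim := hBanti.tendsto_nhdsGT 0
  set a := sSup (A '' Ioi 0) with ha
  set b := sSup (B '' Ioi 0) with hb
  have hbM : b ≤ M := sSup_le (by rintro _ ⟨ε, hε, rfl⟩; exact hBM ε hε)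
  have hbtop : b ≠ ⊤ := (hbM.trans_lt ENNReal.ofReal_lt_top).ne
  have hbe : (b : EReal) ≠ ⊤ := by simpa using hbtop
  refine ⟨(a : EReal) + -(b : EReal), ?_, fun hL ε hε => ?_⟩
  · have h1 : Tendsto (fun ε => ((A ε : ENNReal) : EReal)) (𝓝[>] 0) (𝓝 (a : EReal)) :=
      (continuous_coe_ennreal_ereal.tendsto a).comp hAlim
    have h2 : Tendsto (fun ε => -((B ε : ENNReal) : EReal)) (𝓝[>] 0) (𝓝 (-(b : EReal))) :=
      (continuous_neg.tendsto _).comp ((continuous_coe_ennreal_ereal.tendsto b).comp hBlim)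
    have h3 := (EReal.continuousAt_add (p := ((a : EReal), -(b : EReal)))
      (Or.inr (by simpa using hbtop)) (Or.inl (by simp))).tendsto.comp (h1.prodMk_nhds h2)
    refine h3.congr' ?_
    filter_upwards [self_mem_nhdsWithin] with ε hε
    have hε : 0 < ε := hε
    have hi := hK.integrableOn_symmIntegrand hs.1 hlam hLam hF x hε
    have hAt : A ε ≠ ⊤ := by
      refine (lt_of_le_of_lt (lintegral_mono fun u => ?_) hi.hasFiniteIntegral).ne
      exact Real.ofReal_le_enorm _
    have hBt : B ε ≠ ⊤ := ((hBM ε hε).trans_lt ENNReal.ofReal_lt_top).ne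
    rw [hK.truncatedCurvature_eq hs.1 hlam hLam hF x hε,
      integral_eq_lintegral_pos_part_sub_lintegral_neg_part hi, EReal.coe_sub,
      EReal.coe_ennreal_toReal hAt, EReal.coe_ennreal_toReal hBt]
    rfl
  · rw [← sub_eq_add_neg, EReal.sub_nonpos, EReal.coe_ennreal_le_coe_ennreal_iff] at hL
    exact (le_sSup ⟨ε, hε, rfl⟩ : A ε ≤ a).trans (hL.trans hbM)

/-! ### Density at touching points. -/

/-- At a point touched by a ball of radius `ρ` in the complement, where the curvature is
nonpositive, the set has positive density at scale `ρ`. -/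
theorem le_volume_inter_ball_of_touching (hK : IsEllipticKernel s lam Lam K) (hd : 1 ≤ d)
    (hs : s ∈ Ioo (0 : ℝ) 1) (hlam : 0 < lam) {F : Set (Euc d)}
    (hF : MeasurableSet F) {x z : Euc d} {ρ : ℝ} (hρ : 0 < ρ) (hball : Metric.ball z ρ ⊆ Fᶜ)
    (hx : x ∈ Metric.sphere z ρ)
    (hmass : ∀ ε > 0,
        ∫⁻ u in (Metric.ball (0 : Euc d) ε)ᶜ, ENNReal.ofReal (symmIntegrand K F x u) ≤
          ENNReal.ofReal (Lam * cuspConst d s * ρ ^ (-s)))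
    {t : ℝ} (ht : t ∈ Ioc (0 : ℝ) 1)
    (hts : Lam * cuspConst d s * t ^ s ≤ lam * (ballVolume d * (1 / 8) ^ d)) :
    ENNReal.ofReal (ballVolume d * (t / 8) ^ d * ρ ^ d) ≤ volume (F ∩ Metric.ball x ρ) := by
  obtain ⟨ht0, ht1⟩ := ht
  have hω := ballVolume_pos d
  have htρ : 0 < t * ρ := by positivity
  have hv : ‖z - x‖ = ρ := by rw [← dist_eq_norm, dist_comm]; exact hx
  -- The ball of radius tρ/2 about w has 0 on its boundary, and its translate by x lies in the
  -- touching ball.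
  set w : Euc d := (t / 2) • (z - x) with hw
  set N : Set (Euc d) := (fun u => x - u) ⁻¹' (F ∩ Metric.ball x ρ) with hN
  have hNm : MeasurableSet N := (by fun_prop : Measurable fun u : Euc d => x - u)
    (hF.inter Metric.isOpen_ball.measurableSet)
  have hNvol : volume N = volume (F ∩ Metric.ball x ρ) :=
    (Measure.measurePreserving_sub_left volume x).measure_preimage
      (hF.inter Metric.isOpen_ball.measurableSet).nullMeasurableSet
  -- On S both x + u and x - u are outside F, so the symmetrized integrand equals K there. The ball
  -- of radius tρ/8 is removed because the mass bound is only available away from 0.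
  set S : Set (Euc d) :=
    (Metric.ball w (t * ρ / 2) \ Metric.ball 0 (t * ρ / 8)) \ N with hS
  have hSm : MeasurableSet S :=
    (Metric.isOpen_ball.measurableSet.diff Metric.isOpen_ball.measurableSet).diff hNm
  have hwn : ‖w‖ = t * ρ / 2 := by
    rw [hw, norm_smul, hv, Real.norm_of_nonneg (by positivity)]; ring
  have hSprop : ∀ u ∈ S, u ≠ 0 ∧ ‖u‖ < t * ρ ∧ symmIntegrand K F x u = K u := by
    rintro u ⟨⟨hu1, hu2⟩, hu3⟩
    have hu1' : ‖u - w‖ < t * ρ / 2 := by simpa [dist_eq_norm] using hu1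
    have hun : ‖u‖ < t * ρ := by
      calc ‖u‖ = ‖(u - w) + w‖ := by rw [sub_add_cancel]
        _ ≤ _ := norm_add_le _ _
        _ < _ := by rw [hwn]; linarith
    have hunρ : ‖u‖ < ρ := hun.trans_le (mul_le_of_le_one_left hρ.le ht1)
    have hu0 : u ≠ 0 := by
      rintro rfl
      exact hu2 (by simp; positivity)
    refine ⟨hu0, hun, ?_⟩
    have h1 : x + u ∉ F := hball (by
      rw [Metric.mem_ball, dist_eq_norm]
      calc ‖x + u - z‖ = ‖(u - w) - (1 - t / 2) • (z - x)‖ := by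
            congr 1; rw [hw]; module
        _ ≤ ‖u - w‖ + ‖(1 - t / 2) • (z - x)‖ := norm_sub_le _ _
        _ = ‖u - w‖ + (1 - t / 2) * ρ := by
            rw [norm_smul, hv, Real.norm_of_nonneg (by linarith)]
        _ < ρ := by linarith)
    have h2 : x - u ∉ F := fun h => hu3 ⟨h, by simpa [dist_eq_norm] using hunρ⟩
    rw [symmIntegrand, signedChar_of_notMem h1, signedChar_of_notMem h2]
    ring
  -- On S the kernel is at least lam (tρ)^{-(d+s)}. The mass bound gives |S| ≤ (Lam C t^s /
  -- lam)(tρ)^d with C = `cuspConst d s`, and `hts` makes this at most the volume of a ball of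
  -- radius tρ/8.
  have hSvol : volume S ≤ ENNReal.ofReal (ballVolume d * (1 / 8) ^ d * (t * ρ) ^ d) := by
    have hc : 0 < lam / (t * ρ) ^ ((d : ℝ) + s) := by positivity
    have h := hmass (t * ρ / 8) (by positivity)
    have h' : ENNReal.ofReal (lam / (t * ρ) ^ ((d : ℝ) + s)) * volume S ≤
        ENNReal.ofReal (Lam * cuspConst d s * ρ ^ (-s)) := by
      refine le_trans ?_ h
      rw [← setLIntegral_const]
      calc _ ≤ ∫⁻ u in S, ENNReal.ofReal (symmIntegrand K F x u) := by
            refine setLIntegral_mono' hSm fun u hu => ENNReal.ofReal_le_ofReal ?_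
            obtain ⟨hu0, hun, hu⟩ := hSprop u hu
            rw [hu]
            refine le_trans ?_ (hK.lower u hu0)
            have : 0 < ‖u‖ := norm_pos_iff.2 hu0
            have := hs.1
            gcongr
        _ ≤ _ := lintegral_mono_set fun u hu => hu.1.2
    rw [← ENNReal.mul_le_mul_iff_right (a := ENNReal.ofReal (lam / (t * ρ) ^ ((d : ℝ) + s)))
      (by simpa using hc) ENNReal.ofReal_ne_top]
    refine h'.trans ?_
    rw [← ENNReal.ofReal_mul hc.le]
    refine ENNReal.ofReal_le_ofReal ?_
    have e : lam / (t * ρ) ^ ((d : ℝ) + s) * (ballVolume d * (1 / 8) ^ d * (t * ρ) ^ d) =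
        lam * (ballVolume d * (1 / 8) ^ d) * t ^ (-s) * ρ ^ (-s) := by
      rw [Real.rpow_add htρ, Real.rpow_natCast, mul_assoc _ (t ^ (-s)),
        ← Real.mul_rpow ht0.le hρ.le, Real.rpow_neg htρ.le]
      field_simp
    rw [e]
    refine mul_le_mul_of_nonneg_right ?_ (by positivity)
    calc Lam * cuspConst d s = Lam * cuspConst d s * t ^ s * t ^ (-s) := by
          rw [mul_assoc, ← Real.rpow_add ht0]; simp
      _ ≤ _ := by gcongr
  have hcover : volume (Metric.ball w (t * ρ / 2)) ≤
      volume S + volume (Metric.ball (0 : Euc d) (t * ρ / 8)) + volume N := by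
    refine (measure_mono ?_).trans ((measure_union_le _ _).trans
      (add_le_add_left (measure_union_le _ _) _))
    intro u hu
    by_cases h1 : u ∈ N
    · exact Or.inr h1
    · by_cases h2 : u ∈ Metric.ball (0 : Euc d) (t * ρ / 8)
      · exact Or.inl (Or.inr h2)
      · exact Or.inl (Or.inl ⟨⟨hu, h2⟩, h1⟩)
  rw [volume_ball_eq _ (by positivity), volume_ball_eq _ (by positivity), hNvol] at hcover
  have h2 := hcover.trans (add_le_add_left (add_le_add_left hSvol _) _)
  rw [← ENNReal.ofReal_add (by positivity) (by positivity)] at h2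
  have hle : ballVolume d * (t / 8) ^ d * ρ ^ d ≤ ballVolume d * (t * ρ / 2) ^ d -
      (ballVolume d * (1 / 8) ^ d * (t * ρ) ^ d + ballVolume d * (t * ρ / 8) ^ d) := by
    -- In units of the ball of radius tρ/8, the large ball has volume 4^d, while S and the removed
    -- ball take at most 1 each; at least 1 is left for N.
    have e4 : (3 : ℝ) ≤ 4 ^ d := by
      calc (3 : ℝ) ≤ 4 ^ 1 := by norm_num
        _ ≤ 4 ^ d := pow_le_pow_right₀ (by norm_num) hd
    have e1 : (t * ρ / 2) ^ d = 4 ^ d * (t * ρ / 8) ^ d := by rw [← mul_pow]; congr 1; ring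
    have e2 : (1 / 8 : ℝ) ^ d * (t * ρ) ^ d = (t * ρ / 8) ^ d := by
      rw [← mul_pow]; congr 1; ring
    have e3 : (t / 8 : ℝ) ^ d * ρ ^ d = (t * ρ / 8) ^ d := by
      rw [← mul_pow]; congr 1; ring
    rw [mul_assoc, e3, mul_assoc, e2, e1]
    have : 0 ≤ ballVolume d * (t * ρ / 8) ^ d := by positivity
    nlinarith
  refine (ENNReal.ofReal_le_ofReal hle).trans ?_
  rw [ENNReal.ofReal_sub _ (by positivity)]
  exact tsub_le_iff_left.2 h2

end IsEllipticKernel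

/-! ### From touching points to all scales by a Vitali covering. -/

/-- If every boundary point touched by a ball of the complement has positive density at the scale
of that ball, then the set has positive density at every scale around each boundary point. -/
theorem le_volume_inter_ball_of_frontier {d : ℕ} {F : Set (Euc d)} {c : ℝ} (hc : 0 < c)
    (hF : MeasurableSet F) (hnull : volume (frontier F) = 0) (h0 : (0 : Euc d) ∈ frontier F)
    (htouch : ∀ x ∈ frontier F, ∀ (z : Euc d) (ρ : ℝ), 0 < ρ → Metric.ball z ρ ⊆ Fᶜ →
      x ∈ Metric.sphere z ρ → ENNReal.ofReal (c * ρ ^ d) ≤ volume (F ∩ Metric.ball x ρ))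
    {r : ℝ} (hr : 0 < r) :
    ENNReal.ofReal (ballVolume d * (1 / 4) ^ d / (10 ^ d * ballVolume d / c + 1) * r ^ d) ≤
      volume (F ∩ Metric.ball 0 r) := by
  have hω := ballVolume_pos d
  have hne : F.Nonempty := closure_nonempty_iff.1 ⟨0, frontier_subset_closure h0⟩
  set ρ : Euc d → ℝ := fun z => Metric.infDist z F with hρdef
  set T : Set (Euc d) := Metric.ball 0 (r / 4) \ closure F with hT
  have hρpos : ∀ z ∈ T, 0 < ρ z := fun z hz =>
    (Metric.infDist_pos_iff_notMem_closure hne).1 hz.2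
  have hρle : ∀ z ∈ T, ρ z < r / 4 := fun z hz => by
    calc ρ z = Metric.infDist z (closure F) := (Metric.infDist_closure).symm
      _ ≤ dist z 0 := Metric.infDist_le_dist_of_mem (frontier_subset_closure h0)
      _ < r / 4 := hz.1
  have hdens : ∀ z ∈ T, ENNReal.ofReal (c * ρ z ^ d) ≤
      volume (F ∩ Metric.closedBall z (2 * ρ z)) := by
    intro z hz
    -- The nearest point x of the closure is touched by the ball about z of radius ρ z, and the ball
    -- of that radius about x lies in the closed ball of radius 2ρ z about z.
    obtain ⟨x, hxF, hx⟩ := isClosed_closure.exists_infDist_eq_dist (hne.mono subset_closure) z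
    rw [Metric.infDist_closure] at hx
    have hball : Metric.ball z (ρ z) ⊆ Fᶜ := fun y hy hyF =>
      absurd (Metric.infDist_le_dist_of_mem hyF) (by
        rw [not_le, dist_comm]; exact hy)
    have hxs : x ∈ Metric.sphere z (ρ z) := by
      rw [Metric.mem_sphere, dist_comm]; exact hx.symm
    have hxfr : x ∈ frontier F := by
      rw [frontier_eq_closure_inter_closure]
      refine ⟨hxF, closure_mono hball ?_⟩
      rw [closure_ball z (hρpos z hz).ne']
      exact Metric.sphere_subset_closedBall hxs
    refine (htouch x hxfr z _ (hρpos z hz) hball hxs).trans (measure_mono ?_)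
    refine inter_subset_inter_right _ fun y hy => ?_
    rw [Metric.mem_closedBall]
    calc dist y z ≤ dist y x + dist x z := dist_triangle _ _ _
      _ ≤ ρ z + ρ z := add_le_add (Metric.mem_ball.1 hy).le (Metric.mem_sphere.1 hxs).le
      _ = 2 * ρ z := by ring
  obtain ⟨u, huT, hdisj, hcov⟩ :=
    Vitali.exists_disjoint_subfamily_covering_enlargement_closedBall T id (fun z => 2 * ρ z) (r / 2)
      (fun z hz => by linarith [hρle z hz]) 5 (by norm_num)
  simp only [id] at hdisj hcov
  have hcount : u.Countable := by
    refine hdisj.countable_of_nonempty_interior fun z hz => ⟨z, ?_⟩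
    exact Metric.ball_subset_interior_closedBall
      (Metric.mem_ball_self (by linarith [hρpos z (huT hz)]))
  have hTvol : volume T ≤ ENNReal.ofReal (10 ^ d * ballVolume d / c) *
      volume (F ∩ Metric.ball 0 r) := by
    calc volume T ≤ volume (⋃ z ∈ u, Metric.closedBall z (5 * (2 * ρ z))) := by
          refine measure_mono fun z hz => ?_
          obtain ⟨b, hb, hsub⟩ := hcov z hz
          exact mem_iUnion₂.2 ⟨b, hb, hsub (Metric.mem_closedBall_self
            (by linarith [hρpos z hz]))⟩
      _ ≤ ∑' z : u, volume (Metric.closedBall (z : Euc d) (5 * (2 * ρ z))) :=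
          measure_biUnion_le _ hcount _
      _ ≤ ∑' z : u, ENNReal.ofReal (10 ^ d * ballVolume d / c) *
            volume (F ∩ Metric.closedBall (z : Euc d) (2 * ρ z)) := by
          refine ENNReal.tsum_le_tsum fun z => ?_
          have hp := hρpos z (huT z.2)
          rw [volume_closedBall_eq _ (by positivity)]
          refine le_trans ?_ (mul_le_mul_right (hdens z (huT z.2)) _)
          rw [← ENNReal.ofReal_mul (by positivity)]
          apply le_of_eq
          congr 1
          rw [← mul_assoc 5 2, mul_pow]
          norm_num
          field_simp
      _ = ENNReal.ofReal (10 ^ d * ballVolume d / c) *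
            volume (⋃ z ∈ u, F ∩ Metric.closedBall (z : Euc d) (2 * ρ z)) := by
          rw [ENNReal.tsum_mul_left, measure_biUnion hcount
            (hdisj.mono fun z => inter_subset_right)
            fun z _ => hF.inter Metric.isClosed_closedBall.measurableSet]
      -- Centres lie in B_{r/4} and ρ z < r/4, so the selected balls stay within radius 3r/4.
      _ ≤ _ := by
          refine mul_le_mul_right (measure_mono (iUnion₂_subset fun z hz => ?_)) _
          refine inter_subset_inter_right _ fun y hy => ?_
          have h1 : dist y z ≤ 2 * ρ z := hy
          have h2 : dist z 0 < r / 4 := (huT hz).1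
          have h3 := hρle z (huT hz)
          rw [Metric.mem_ball]
          linarith [dist_triangle y z 0]
  have hball : volume (Metric.ball (0 : Euc d) (r / 4)) ≤
      volume T + volume (F ∩ Metric.ball 0 r) := by
    calc volume (Metric.ball (0 : Euc d) (r / 4))
        -- T omits the closure of F; points of the closure outside F lie in the null frontier.
        ≤ volume (T ∪ ((F ∩ Metric.ball 0 r) ∪ frontier F)) := by
          refine measure_mono fun y hy => ?_
          by_cases h1 : y ∈ closure F
          · by_cases h2 : y ∈ F
            · exact Or.inr (Or.inl ⟨h2, Metric.ball_subset_ball (by linarith) hy⟩)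
            · exact Or.inr (Or.inr ⟨h1, fun h => h2 (interior_subset h)⟩)
          · exact Or.inl ⟨hy, h1⟩
      _ ≤ _ := (measure_union_le _ _).trans (add_le_add_right
          ((measure_union_le _ _).trans (by rw [hnull, add_zero])) _)
  have hfin := hball.trans (add_le_add_left hTvol _)
  rw [volume_ball_eq _ (by positivity)] at hfin
  have hk : 0 < 10 ^ d * ballVolume d / c + 1 := by positivity
  rw [← ENNReal.mul_le_mul_iff_right
    (a := ENNReal.ofReal (10 ^ d * ballVolume d / c + 1)) (by simpa using hk)
    ENNReal.ofReal_ne_top, ← ENNReal.ofReal_mul hk.le]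
  calc _ = ENNReal.ofReal (ballVolume d * (r / 4) ^ d) := by
        congr 1
        rw [div_eq_mul_one_div r, mul_pow]
        field_simp
    _ ≤ _ := hfin
    _ = _ := by rw [ENNReal.ofReal_add (by positivity) (by positivity), add_mul]; simp

/-! ### Passing to the complement and density of both phases. -/

theorem truncatedCurvature_compl {d : ℕ} (K : Euc d → ℝ) (F : Set (Euc d)) (x : Euc d) (ε : ℝ) :
    truncatedCurvature K Fᶜ x ε = -truncatedCurvature K F x ε := by
  rw [truncatedCurvature, truncatedCurvature, ← integral_neg]
  refine integral_congr_ae (ae_of_all _ fun u => ?_)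
  simp only [signedChar_compl, neg_mul]

namespace IsEllipticKernel

variable {d : ℕ} {s lam Lam : ℝ} {K : Euc d → ℝ}

/-- Complementation negates every truncated integral. Since `nonlocalCurvature` is a `limUnder`, the
sign passes to it only once the limit is known to exist, which the touching ball guarantees. -/
theorem viscosityLE_compl (hK : IsEllipticKernel s lam Lam K)
    (hs : s ∈ Ioo (0 : ℝ) 1) (hlam : 0 < lam) (hLam : 0 ≤ Lam) {F Ω : Set (Euc d)}
    (hF : MeasurableSet F) (h : ViscosityGE K F Ω 0) : ViscosityLE K Fᶜ Ω 0 := by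
  rintro x ⟨hx, hxΩ⟩ ht
  rw [frontier_compl] at hx
  rw [compl_compl] at ht
  have h1 := h x ⟨hx, hxΩ⟩ ht
  obtain ⟨z, ρ, hρ, hball, hxs⟩ := ht
  obtain ⟨L, hL, -⟩ := hK.exists_tendsto_truncatedCurvature hs hlam hLam hF.compl hρ
    (by rwa [compl_compl]) hxs
  have hL' : Tendsto (fun ε => ((truncatedCurvature K F x ε : ℝ) : EReal)) (𝓝[>] 0) (𝓝 (-L)) := by
    refine ((continuous_neg.tendsto L).comp hL).congr fun ε => ?_
    simp [truncatedCurvature_compl]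
  rw [nonlocalCurvature, hL'.limUnder_eq] at h1
  rw [nonlocalCurvature, hL.limUnder_eq]
  rw [EReal.coe_zero] at h1 ⊢
  simpa using h1

end IsEllipticKernel

/-- Uniform density estimate for both phases of a set with zero nonlocal curvature. -/
theorem exists_density_const (d : ℕ) (hd : 1 ≤ d) {s lam Lam : ℝ} (hs : s ∈ Ioo (0 : ℝ) 1)
    (hlam : 0 < lam) (hLam : 0 ≤ Lam) :
    ∃ c : ℝ, 0 < c ∧ ∀ K : Euc d → ℝ, IsEllipticKernel s lam Lam K →
      ∀ F : Set (Euc d), MeasurableSet F → volume (frontier F) = 0 → (0 : Euc d) ∈ frontier F →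
      ViscosityEq K F univ 0 → ∀ r : ℝ, 0 < r →
        ENNReal.ofReal (c * r ^ d) ≤ volume (F ∩ Metric.ball 0 r) ∧
        ENNReal.ofReal (c * r ^ d) ≤ volume (Fᶜ ∩ Metric.ball 0 r) := by
  have hω := ballVolume_pos d
  have hC := cuspConst_pos d hs
  -- Since s > 0, t^s tends to 0; t depends only on d, s, lam and Lam.
  obtain ⟨t, ht, hts⟩ : ∃ t ∈ Ioc (0 : ℝ) 1,
      Lam * cuspConst d s * t ^ s ≤ lam * (ballVolume d * (1 / 8) ^ d) := by
    have hlim : Tendsto (fun t : ℝ => Lam * cuspConst d s * t ^ s) (𝓝[>] 0) (𝓝 0) := by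
      have := ((Real.continuous_rpow_const hs.1.le).tendsto 0).const_mul (Lam * cuspConst d s)
      rw [Real.zero_rpow hs.1.ne', mul_zero] at this
      exact this.mono_left nhdsWithin_le_nhds
    have h1 := hlim.eventually_le_const
      (show (0 : ℝ) < lam * (ballVolume d * (1 / 8) ^ d) by positivity)
    obtain ⟨t, h2, h3⟩ := (h1.and (Ioc_mem_nhdsGT one_pos)).exists
    exact ⟨t, h3, h2⟩
  have ht0 := ht.1
  have hc : 0 < ballVolume d * (t / 8) ^ d := by positivity
  refine ⟨ballVolume d * (1 / 4) ^ d /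
    (10 ^ d * ballVolume d / (ballVolume d * (t / 8) ^ d) + 1), by positivity,
    fun K hK F hF hnull h0 hvis r hr => ?_⟩
  have main : ∀ F : Set (Euc d), MeasurableSet F → ViscosityLE K F univ 0 → ∀ x ∈ frontier F,
      ∀ (z : Euc d) (ρ : ℝ), 0 < ρ → Metric.ball z ρ ⊆ Fᶜ → x ∈ Metric.sphere z ρ →
      ENNReal.ofReal (ballVolume d * (t / 8) ^ d * ρ ^ d) ≤ volume (F ∩ Metric.ball x ρ) := by
    intro F hF hle x hx z ρ hρ hball hxs
    obtain ⟨L, hL, hmass⟩ := hK.exists_tendsto_truncatedCurvature hs hlam hLam hF hρ hball hxs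
    have h1 := hle x ⟨hx, mem_univ x⟩ ⟨z, ρ, hρ, hball, hxs⟩
    rw [nonlocalCurvature, hL.limUnder_eq, EReal.coe_zero] at h1
    exact hK.le_volume_inter_ball_of_touching hd hs hlam hF hρ hball hxs (hmass h1) ht hts
  exact ⟨le_volume_inter_ball_of_frontier hc hF hnull h0 (main F hF hvis.1) hr,
    le_volume_inter_ball_of_frontier hc hF.compl (by rwa [frontier_compl])
      (by rwa [frontier_compl])
      (main Fᶜ hF.compl (hK.viscosityLE_compl hs hlam hLam hF hvis.2)) hr⟩

/-! ### Fractional perimeter: upper bound for balls, lower bound from density. -/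

/-- For |h| < r the set lies in the shell between radii r - |h| and r, whose volume Bernoulli's
inequality controls; for |h| ≥ r the full ball suffices. -/
theorem volume_ball_diff_translate_le {d : ℕ} (hd : 1 ≤ d) {r : ℝ} (hr : 0 < r) (h : Euc d) :
    volume {x : Euc d | x ∈ Metric.ball 0 r ∧ x + h ∉ Metric.ball 0 r} ≤
      ENNReal.ofReal (d * ballVolume d * r ^ (d - 1) * min ‖h‖ r) := by
  have hω := ballVolume_pos d
  have hpow : r ^ d = r ^ (d - 1) * r := by rw [← pow_succ, Nat.sub_add_cancel hd]
  have hd' : (1 : ℝ) ≤ d := by exact_mod_cast hd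
  rcases lt_or_ge ‖h‖ r with hh | hh
  · rw [min_eq_left hh.le]
    have hsub : {x : Euc d | x ∈ Metric.ball 0 r ∧ x + h ∉ Metric.ball 0 r} ⊆
        Metric.ball 0 r \ Metric.ball 0 (r - ‖h‖) := by
      rintro x ⟨hx1, hx2⟩
      refine ⟨hx1, fun hx3 => hx2 ?_⟩
      rw [mem_ball_zero_iff] at hx3 ⊢
      linarith [norm_add_le x h]
    refine (measure_mono hsub).trans ?_
    rw [measure_sdiff (Metric.ball_subset_ball (by linarith [norm_nonneg h]))
      Metric.isOpen_ball.measurableSet.nullMeasurableSet Metric.isBounded_ball.measure_lt_top.ne,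
      volume_ball_eq _ hr, volume_ball_eq _ (sub_pos.2 hh), ← ENNReal.ofReal_sub _ (by
        have := sub_pos.2 hh
        positivity)]
    refine ENNReal.ofReal_le_ofReal ?_
    have hB : 1 + (d : ℝ) * (-(‖h‖ / r)) ≤ (1 + -(‖h‖ / r)) ^ d :=
      one_add_mul_le_pow (by
        have : ‖h‖ / r ≤ 1 := (div_le_one hr).2 hh.le
        linarith) d
    have e : (r - ‖h‖) ^ d = r ^ d * (1 + -(‖h‖ / r)) ^ d := by
      rw [← mul_pow]; congr 1; field_simp; ring
    have h2 : r ^ d * (1 + (d : ℝ) * (-(‖h‖ / r))) ≤ (r - ‖h‖) ^ d := by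
      rw [e]; gcongr
    have e2 : r ^ d * (1 + (d : ℝ) * (-(‖h‖ / r))) = r ^ d - d * r ^ (d - 1) * ‖h‖ := by
      rw [hpow]; field_simp; ring
    rw [e2] at h2
    nlinarith
  · rw [min_eq_right hh]
    refine (measure_mono fun x hx => hx.1).trans ?_
    rw [volume_ball_eq _ hr]
    refine ENNReal.ofReal_le_ofReal ?_
    rw [hpow]
    have : 0 ≤ ballVolume d * (r ^ (d - 1) * r) := by positivity
    nlinarith

theorem lintegral_abs_signedChar_ball_sub_le {d : ℕ} (hd : 1 ≤ d) {r : ℝ} (hr : 0 < r)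
    (h : Euc d) :
    ∫⁻ x : Euc d, ENNReal.ofReal
        |signedChar (Metric.ball 0 r) x - signedChar (Metric.ball 0 r) (x + h)| ≤
      ENNReal.ofReal (4 * (d * ballVolume d * r ^ (d - 1)) * min ‖h‖ r) := by
  have hω := ballVolume_pos d
  set B : Set (Euc d) := Metric.ball 0 r with hB
  have hBm : MeasurableSet B := Metric.isOpen_ball.measurableSet
  set S₁ : Set (Euc d) := {x | x ∈ B ∧ x + h ∉ B} with hS₁
  set S₂ : Set (Euc d) := {x | x ∈ B ∧ x + -h ∉ B} with hS₂
  have hS₁m : MeasurableSet S₁ :=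
    hBm.inter ((by fun_prop : Measurable fun x : Euc d => x + h) hBm.compl)
  have hS₂m : MeasurableSet S₂ :=
    hBm.inter ((by fun_prop : Measurable fun x : Euc d => x + -h) hBm.compl)
  calc _ ≤ ∫⁻ x : Euc d, (S₁.indicator (fun _ => 2) x + S₂.indicator (fun _ => 2) (x + h)) := by
        refine lintegral_mono fun x => ?_
        by_cases h1 : x ∈ B <;> by_cases h2 : x + h ∈ B
        · simp [signedChar_of_mem h1, signedChar_of_mem h2]
        · have : x ∈ S₁ := ⟨h1, h2⟩
          rw [indicator_of_mem this, signedChar_of_mem h1, signedChar_of_notMem h2]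
          norm_num
        · have : x + h ∈ S₂ := ⟨h2, by simpa using h1⟩
          rw [indicator_of_mem this, signedChar_of_notMem h1, signedChar_of_mem h2]
          norm_num
        · simp [signedChar_of_notMem h1, signedChar_of_notMem h2]
    _ = 2 * volume S₁ + 2 * volume S₂ := by
        rw [lintegral_add_left (measurable_const.indicator hS₁m),
          lintegral_add_right_eq_self (fun x => S₂.indicator (fun _ => (2 : ENNReal)) x),
          lintegral_indicator_const hS₁m, lintegral_indicator_const hS₂m]
    _ ≤ 2 * ENNReal.ofReal (d * ballVolume d * r ^ (d - 1) * min ‖h‖ r) +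
        2 * ENNReal.ofReal (d * ballVolume d * r ^ (d - 1) * min ‖h‖ r) := by
        refine add_le_add (mul_le_mul_right (volume_ball_diff_translate_le hd hr h) _)
          (mul_le_mul_right ?_ _)
        have := volume_ball_diff_translate_le hd hr (-h)
        rwa [norm_neg] at this
    _ = _ := by
        rw [← add_mul, show (2 : ENNReal) + 2 = ENNReal.ofReal 4 by norm_num,
          ← ENNReal.ofReal_mul (by norm_num), ← mul_assoc]

/-- Write y = x + u and integrate in x first. The translation estimate replaces the singular kernel
by min(|u|, r)|u|^{-(d+α)}, integrable at 0 because α < 1 and at infinity because α > 0. -/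
theorem fractionalPerimeter_ball_le {d : ℕ} (hd : 1 ≤ d) {α : ℝ} (hα : α ∈ Ioo (0 : ℝ) 1) :
    ∃ C : ℝ, 0 < C ∧ ∀ r : ℝ, 0 < r →
      fractionalPerimeter α (Metric.ball (0 : Euc d) r) univ ≤
        ENNReal.ofReal (C * r ^ ((d : ℝ) - α)) := by
  have hω := ballVolume_pos d
  have hα0 := hα.1
  have hα1 : 0 < 1 - α := sub_pos.2 hα.2
  have hd' : (1 : ℝ) ≤ d := by exact_mod_cast hd
  have hp : 0 < (d : ℝ) + α - 1 := by linarith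
  set C₁ : ℝ := ballVolume d * (((d : ℝ) + α - 1) / (1 - α) + 1) with hC₁
  set C₂ : ℝ := ballVolume d * ((d + α) / α) with hC₂
  have hC₁0 : 0 < C₁ := by positivity
  have hC₂0 : 0 < C₂ := by positivity
  refine ⟨4 * (d * ballVolume d) * (C₁ + C₂), by positivity, fun r hr => ?_⟩
  set B : Set (Euc d) := Metric.ball 0 r with hB
  have hBm : MeasurableSet B := Metric.isOpen_ball.measurableSet
  have hχ := measurable_signedChar hBm
  set D : ℝ := 4 * (d * ballVolume d * r ^ (d - 1)) with hD
  have hD0 : 0 < D := by positivity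
  have hmin : ∫⁻ u : Euc d, ENNReal.ofReal (min ‖u‖ r * (1 / ‖u‖ ^ ((d : ℝ) + α))) ≤
      ENNReal.ofReal ((C₁ + C₂) * r ^ (1 - α)) := by
    rw [← lintegral_add_compl _ hBm, add_mul, ENNReal.ofReal_add (by positivity) (by positivity)]
    refine add_le_add ?_ ?_
    · have h1 := lintegral_one_div_norm_rpow_le_of_decay (d := d) (q := d) (A := ballVolume d)
        (S := B) hp (by linarith) hω.le hr subset_rfl (fun t ht => by
          rw [Real.rpow_natCast]
          exact (measure_mono inter_subset_right).trans (volume_ball_eq 0 ht.1).le)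
      rw [show (d : ℝ) - (d + α - 1) = 1 - α by ring] at h1
      refine (lintegral_mono fun u => ENNReal.ofReal_le_ofReal ?_).trans h1
      rcases eq_or_ne u 0 with rfl | hu
      · rw [norm_zero, min_eq_left hr.le, zero_mul]
        positivity
      · have hu' : 0 < ‖u‖ := norm_pos_iff.2 hu
        rw [Real.rpow_sub_one hu'.ne', one_div_div, mul_one_div]
        exact div_le_div_of_nonneg_right (min_le_left _ _) (by positivity)
    · calc _ ≤ ∫⁻ u in Bᶜ, ENNReal.ofReal r * ENNReal.ofReal (1 / ‖u‖ ^ ((d : ℝ) + α)) := by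
            refine lintegral_mono fun u => ?_
            rw [← ENNReal.ofReal_mul hr.le]
            refine ENNReal.ofReal_le_ofReal ?_
            exact mul_le_mul_of_nonneg_right (min_le_right _ _) (by positivity)
        _ ≤ ENNReal.ofReal r * ENNReal.ofReal (C₂ * r ^ (-α)) := by
            rw [lintegral_const_mul' _ _ ENNReal.ofReal_ne_top]
            exact mul_le_mul_right (lintegral_compl_ball_one_div_norm_rpow_le hα0 hr) _
        _ = _ := by
            rw [← ENNReal.ofReal_mul hr.le]
            congr 1
            rw [sub_eq_add_neg, Real.rpow_add hr, Real.rpow_one]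
            ring
  have hm : Measurable fun q : Euc d × Euc d => ENNReal.ofReal
      (|signedChar B q.1 - signedChar B q.2| * (1 / ‖q.1 - q.2‖ ^ ((d : ℝ) + α))) :=
    (((hχ.comp measurable_fst).sub (hχ.comp measurable_snd)).abs.mul (by fun_prop)).ennreal_ofReal
  have hm' : Measurable fun q : Euc d × Euc d => ENNReal.ofReal
      (|signedChar B q.1 - signedChar B (q.1 + q.2)| * (1 / ‖q.2‖ ^ ((d : ℝ) + α))) :=
    (((hχ.comp measurable_fst).sub (hχ.comp (by fun_prop))).abs.mul (by fun_prop)).ennreal_ofReal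
  have hmain : ∫⁻ q : Euc d × Euc d, ENNReal.ofReal
      (|signedChar B q.1 - signedChar B q.2| * (1 / ‖q.1 - q.2‖ ^ ((d : ℝ) + α))) ≤
      ENNReal.ofReal (D * ((C₁ + C₂) * r ^ (1 - α))) := by
    calc _ = ∫⁻ x : Euc d, ∫⁻ y : Euc d, ENNReal.ofReal
          (|signedChar B x - signedChar B y| * (1 / ‖x - y‖ ^ ((d : ℝ) + α))) := by
          rw [Measure.volume_eq_prod, lintegral_prod _ hm.aemeasurable]
      _ = ∫⁻ x : Euc d, ∫⁻ u : Euc d, ENNReal.ofReal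
          (|signedChar B x - signedChar B (x + u)| * (1 / ‖u‖ ^ ((d : ℝ) + α))) := by
          refine lintegral_congr fun x => ?_
          rw [← lintegral_add_left_eq_self _ x]
          refine lintegral_congr fun u => ?_
          rw [sub_add_cancel_left, norm_neg]
      _ = ∫⁻ u : Euc d, ∫⁻ x : Euc d, ENNReal.ofReal
          (|signedChar B x - signedChar B (x + u)| * (1 / ‖u‖ ^ ((d : ℝ) + α))) :=
          lintegral_lintegral_swap hm'.aemeasurable
      _ ≤ ∫⁻ u : Euc d, ENNReal.ofReal D *
          ENNReal.ofReal (min ‖u‖ r * (1 / ‖u‖ ^ ((d : ℝ) + α))) := by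
          refine lintegral_mono fun u => ?_
          have : ∀ x : Euc d, ENNReal.ofReal
              (|signedChar B x - signedChar B (x + u)| * (1 / ‖u‖ ^ ((d : ℝ) + α))) =
              ENNReal.ofReal |signedChar B x - signedChar B (x + u)| *
                ENNReal.ofReal (1 / ‖u‖ ^ ((d : ℝ) + α)) := fun x =>
            ENNReal.ofReal_mul (abs_nonneg _)
          simp only [this]
          rw [lintegral_mul_const' _ _ ENNReal.ofReal_ne_top, ← ENNReal.ofReal_mul hD0.le,
            ← mul_assoc, ENNReal.ofReal_mul (mul_nonneg hD0.le (le_min (norm_nonneg _) hr.le))]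
          exact mul_le_mul_left (lintegral_abs_signedChar_ball_sub_le hd hr u) _
      _ ≤ _ := by
          rw [lintegral_const_mul' _ _ ENNReal.ofReal_ne_top, ENNReal.ofReal_mul hD0.le]
          exact mul_le_mul_right hmin _
  rw [fractionalPerimeter, nonlocalPerimeter]
  have hu : ((univ : Set (Euc d))ᶜ ×ˢ (univ : Set (Euc d))ᶜ)ᶜ = univ := by simp
  rw [hu, Measure.restrict_univ]
  refine (mul_le_of_le_one_left zero_le (by norm_num)).trans (hmain.trans (le_of_eq ?_))
  congr 1
  have hpow : r ^ ((d : ℝ) - α) = r ^ (d - 1) * r ^ (1 - α) := by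
    rw [← Real.rpow_natCast, ← Real.rpow_add hr, Nat.cast_sub hd]
    congr 1
    push_cast
    ring
  rw [hpow, hD]
  ring

/-- Only pairs with one point in each phase, both in B_r, are kept: the jump is 2 and the distance
at most 2r. With the prefactor 1/4 this yields c²/2. -/
theorem le_fractionalPerimeter {d : ℕ} {α : ℝ} (hα : 0 < α) {c : ℝ} (hc : 0 < c) {r : ℝ}
    (hr : 0 < r) {F : Set (Euc d)} (hF : MeasurableSet F)
    (h1 : ENNReal.ofReal (c * r ^ d) ≤ volume (F ∩ Metric.ball 0 r))
    (h2 : ENNReal.ofReal (c * r ^ d) ≤ volume (Fᶜ ∩ Metric.ball 0 r)) :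
    ENNReal.ofReal (c ^ 2 / 2 / 2 ^ ((d : ℝ) + α) * r ^ ((d : ℝ) - α)) ≤
      fractionalPerimeter α F (Metric.ball 0 r) := by
  set S : Set (Euc d × Euc d) := (F ∩ Metric.ball 0 r) ×ˢ (Fᶜ ∩ Metric.ball 0 r) with hS
  have hSm : MeasurableSet S := (hF.inter Metric.isOpen_ball.measurableSet).prod
    (hF.compl.inter Metric.isOpen_ball.measurableSet)
  have key : ENNReal.ofReal (2 / (2 * r) ^ ((d : ℝ) + α)) *
      (ENNReal.ofReal (c * r ^ d) * ENNReal.ofReal (c * r ^ d)) ≤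
      ∫⁻ p in ((Metric.ball (0 : Euc d) r)ᶜ ×ˢ (Metric.ball (0 : Euc d) r)ᶜ)ᶜ,
        ENNReal.ofReal (|signedChar F p.1 - signedChar F p.2| *
          (1 / ‖p.1 - p.2‖ ^ ((d : ℝ) + α))) := by
    calc _ ≤ ENNReal.ofReal (2 / (2 * r) ^ ((d : ℝ) + α)) * volume S := by
          rw [Measure.volume_eq_prod, hS, Measure.prod_prod]
          gcongr
      _ = ∫⁻ p in S, ENNReal.ofReal (2 / (2 * r) ^ ((d : ℝ) + α)) := (setLIntegral_const _ _).symm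
      _ ≤ ∫⁻ p in S, ENNReal.ofReal (|signedChar F p.1 - signedChar F p.2| *
          (1 / ‖p.1 - p.2‖ ^ ((d : ℝ) + α))) := by
          refine setLIntegral_mono' hSm fun p hp => ENNReal.ofReal_le_ofReal ?_
          obtain ⟨⟨hp1, hp2⟩, hp3, hp4⟩ := hp
          rw [signedChar_of_mem hp1, signedChar_of_notMem hp3]
          rw [mem_ball_zero_iff] at hp2 hp4
          have hne : 0 < ‖p.1 - p.2‖ := norm_pos_iff.2 (sub_ne_zero.2 fun h => hp3 (h ▸ hp1))
          have hle : ‖p.1 - p.2‖ ≤ 2 * r := by linarith [norm_sub_le p.1 p.2]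
          rw [show |(-1 : ℝ) - 1| = 2 by norm_num, mul_one_div]
          gcongr
      _ ≤ _ := lintegral_mono_set (by rintro p ⟨⟨-, hp⟩, -⟩ ⟨h, -⟩; exact h hp)
  rw [fractionalPerimeter, nonlocalPerimeter]
  refine le_trans (le_of_eq ?_) (mul_le_mul_right key _)
  rw [← ENNReal.ofReal_mul (by positivity), ← ENNReal.ofReal_mul (by positivity),
    show (4⁻¹ : ENNReal) = ENNReal.ofReal 4⁻¹ by rw [ENNReal.ofReal_inv_of_pos (by norm_num)]; simp,
    ← ENNReal.ofReal_mul (by positivity)]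
  congr 1
  rw [Real.mul_rpow (by norm_num) hr.le, Real.rpow_sub hr, Real.rpow_add hr, Real.rpow_natCast]
  field_simp
  norm_num

/-! ### Classical perimeter: translations, balls and a relative isoperimetric inequality. -/

theorem hasDerivAt_setIntegral_translate {d : ℕ} {φ : Euc d → ℝ} (hφ : ContDiff ℝ 1 φ)
    (hc : HasCompactSupport φ) (S : Set (Euc d)) (h : Euc d) (t₀ : ℝ) :
    HasDerivAt (fun t : ℝ => ∫ x in S, φ (x + t • h))
      (∫ x in S, fderiv ℝ φ (x + t₀ • h) h) t₀ := by
  have hφ' : Continuous (fderiv ℝ φ) := hφ.continuous_fderiv one_ne_zero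
  obtain ⟨M, hM⟩ := (hc.fderiv ℝ).exists_bound_of_continuous hφ'
  have hM0 : 0 ≤ M := (norm_nonneg _).trans (hM 0)
  obtain ⟨R, hR⟩ := hc.isCompact.isBounded.subset_closedBall 0
  have hcs : HasCompactSupport fun x => φ (x + t₀ • h) :=
    hc.comp_homeomorph (Homeomorph.addRight (t₀ • h))
  refine (hasDerivAt_integral_of_dominated_loc_of_deriv_le (s := Metric.ball t₀ 1)
    (F' := fun t x => fderiv ℝ φ (x + t • h) h)
    -- For |t - t₀| < 1 the translated support stays in this ball, so one integrable bound serves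
    -- all such t.
    (bound := (Metric.closedBall (0 : Euc d) (R + (|t₀| + 1) * ‖h‖)).indicator
      fun _ => M * ‖h‖) (Metric.ball_mem_nhds _ one_pos) ?_ ?_ ?_ ?_ ?_ ?_).2
  · exact Eventually.of_forall fun t =>
      (hφ.continuous.comp (by fun_prop : Continuous fun x : Euc d => x + t • h)).aestronglyMeasurable
  · exact ((hφ.continuous.comp
      (by fun_prop : Continuous fun x : Euc d => x + t₀ • h)).integrable_of_hasCompactSupport
      hcs).integrableOn
  · exact ((hφ'.comp (by fun_prop : Continuous fun x : Euc d => x + t₀ • h)).clm_apply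
      continuous_const).aestronglyMeasurable
  · refine ae_of_all _ fun x t ht => ?_
    by_cases hx : x ∈ Metric.closedBall (0 : Euc d) (R + (|t₀| + 1) * ‖h‖)
    · rw [indicator_of_mem hx]
      exact (ContinuousLinearMap.le_opNorm _ _).trans
        (mul_le_mul_of_nonneg_right (hM _) (norm_nonneg _))
    · rw [indicator_of_notMem hx]
      have : x + t • h ∉ tsupport φ := fun hmem => hx (by
        have h1 := hR hmem
        rw [mem_closedBall_zero_iff] at h1 ⊢
        have h2 : |t| ≤ |t₀| + 1 := by
          have h3 : |t - t₀| < 1 := ht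
          have := abs_sub_abs_le_abs_sub t t₀
          linarith
        calc ‖x‖ = ‖(x + t • h) - t • h‖ := by rw [add_sub_cancel_right]
          _ ≤ ‖x + t • h‖ + ‖t • h‖ := norm_sub_le _ _
          _ ≤ R + (|t₀| + 1) * ‖h‖ := by
              rw [norm_smul, Real.norm_eq_abs]
              gcongr)
      have h0 : fderiv ℝ φ (x + t • h) = 0 := by
        by_contra hne
        exact this (support_fderiv_subset ℝ hne)
      simp [h0]
  · exact ((integrable_indicator_iff Metric.isClosed_closedBall.measurableSet).2
      (integrableOn_const Metric.isBounded_closedBall.measure_lt_top.ne)).integrableOn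
  · refine ae_of_all _ fun x t _ => ?_
    have h1 : HasFDerivAt φ (fderiv ℝ φ (x + t • h)) (x + t • h) :=
      (hφ.differentiable one_ne_zero _).hasFDerivAt
    have h2 : HasDerivAt (fun t : ℝ => x + t • h) h t := by
      simpa using ((hasDerivAt_id t).smul_const h).const_add x
    exact h1.comp_hasDerivAt t h2

/-- The integral is the derivative at t = 0 of the integral of φ over the ball translated by te.
Since |φ| ≤ 1, the increments are controlled by the volume of the symmetric difference of the two
balls, which is linear in |t|. -/
theorem setIntegral_ball_fderiv_le {d : ℕ} (hd : 1 ≤ d) {φ : Euc d → ℝ} (hφ : ContDiff ℝ 1 φ)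
    (hc : HasCompactSupport φ) (hφ1 : ∀ x, |φ x| ≤ 1) {r : ℝ} (hr : 0 < r) {e : Euc d}
    (he : ‖e‖ = 1) :
    ∫ x in Metric.ball 0 r, fderiv ℝ φ x e ≤ 2 * (d * ballVolume d * r ^ (d - 1)) := by
  have hω := ballVolume_pos d
  set B : Set (Euc d) := Metric.ball 0 r with hB
  have hBm : MeasurableSet B := Metric.isOpen_ball.measurableSet
  have hχ := measurable_signedChar hBm
  have hG := hasDerivAt_setIntegral_translate hφ hc B e 0
  simp only [zero_smul, add_zero] at hG
  refine (le_abs_self _).trans (hG.le_of_lip' (by positivity) (Eventually.of_forall fun t => ?_))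
  have hint : Integrable φ := hφ.continuous.integrable_of_hasCompactSupport hc
  have h1 : ∀ t : ℝ, ∫ x in B, φ (x + t • e) =
      ∫ y : Euc d, 2⁻¹ * ((1 - signedChar B (y + -(t • e))) * φ y) := by
    intro t
    rw [← integral_indicator hBm, ← integral_add_right_eq_self
      (fun y : Euc d => 2⁻¹ * ((1 - signedChar B (y + -(t • e))) * φ y)) (t • e)]
    refine integral_congr_ae (ae_of_all _ fun x => ?_)
    by_cases hx : x ∈ B
    · simp [hx, signedChar_of_mem hx]; ring
    · simp [hx, signedChar_of_notMem hx]
  have hi : ∀ v : Euc d, Integrable fun y : Euc d =>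
      2⁻¹ * ((1 - signedChar B (y + v)) * φ y) := fun v => by
    refine (hint.bdd_mul (c := 2)
      ((measurable_const.sub (hχ.comp (by fun_prop))).aestronglyMeasurable)
      (ae_of_all _ fun y => ?_)).const_mul _
    refine (norm_sub_le _ _).trans ?_
    rw [norm_one, Real.norm_eq_abs, Function.comp, abs_signedChar]
    norm_num
  have h2 := h1 0
  simp only [zero_smul, neg_zero, add_zero] at h2
  rw [h1 t]
  simp only [h2, zero_smul, add_zero, sub_zero]
  have hi0 := hi 0
  simp only [add_zero] at hi0
  rw [← integral_sub (hi _) hi0]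
  refine (norm_integral_le_lintegral_norm _).trans ?_
  refine ENNReal.toReal_le_of_le_ofReal (by positivity) ?_
  calc _ ≤ ∫⁻ y : Euc d, ENNReal.ofReal 2⁻¹ *
        ENNReal.ofReal |signedChar B y - signedChar B (y + -(t • e))| := by
        refine lintegral_mono fun y => ?_
        rw [← ENNReal.ofReal_mul (by norm_num)]
        refine ENNReal.ofReal_le_ofReal ?_
        rw [← mul_sub, ← sub_mul, Real.norm_eq_abs, abs_mul, abs_mul, abs_of_pos (by norm_num),
          sub_sub_sub_cancel_left]
        exact mul_le_mul_of_nonneg_left (mul_le_of_le_one_right (abs_nonneg _) (hφ1 y))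
          (by norm_num)
    _ ≤ _ := by
        rw [lintegral_const_mul' _ _ ENNReal.ofReal_ne_top]
        refine (mul_le_mul_right (lintegral_abs_signedChar_ball_sub_le hd hr _) _).trans ?_
        rw [← ENNReal.ofReal_mul (by norm_num)]
        refine ENNReal.ofReal_le_ofReal ?_
        rw [norm_neg, norm_smul, he, mul_one]
        have : min ‖t‖ r ≤ ‖t‖ := min_le_left _ _
        have h0 : 0 ≤ d * ballVolume d * r ^ (d - 1) := by positivity
        nlinarith

/-- Each partial derivative in the divergence is estimated separately; this costs a factor of order
d, harmless here, and avoids the divergence theorem. -/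
theorem classicalPerimeter_ball_le {d : ℕ} (hd : 1 ≤ d) {r : ℝ} (hr : 0 < r) :
    classicalPerimeter (Metric.ball (0 : Euc d) r) univ ≤
      ENNReal.ofReal (2 * (d : ℝ) ^ 2 * ballVolume d * r ^ (d - 1)) := by
  refine iSup_le fun T => iSup_le fun hT => iSup_le fun hTc => iSup_le fun _ => iSup_le fun hT1 =>
    ENNReal.ofReal_le_ofReal ?_
  have hcomp : ∀ i, ContDiff ℝ 1 fun x => T x i := fun i => by fun_prop
  have hcs : ∀ i, HasCompactSupport fun x => T x i := fun i =>
    hTc.comp_left (g := fun y : Euc d => y i) rfl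
  have hf : ∀ x i, fderiv ℝ T x (EuclideanSpace.single i (1 : ℝ)) i =
      fderiv ℝ (fun x => T x i) x (EuclideanSpace.single i (1 : ℝ)) := fun x i => by
    have h1 : HasFDerivAt (fun x => T x i)
        ((EuclideanSpace.proj i : Euc d →L[ℝ] ℝ).comp (fderiv ℝ T x)) x :=
      (EuclideanSpace.proj i : Euc d →L[ℝ] ℝ).hasFDerivAt.comp x
        (hT.differentiable one_ne_zero x).hasFDerivAt
    rw [h1.fderiv]
    rfl
  simp only [divergence, hf]
  rw [integral_finsetSum _ fun i _ => ?_]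
  · calc _ ≤ ∑ i : Fin d, 2 * (d * ballVolume d * r ^ (d - 1)) :=
          Finset.sum_le_sum fun i _ => setIntegral_ball_fderiv_le hd (hcomp i) (hcs i)
            (fun x => (PiLp.norm_apply_le (T x) i).trans (hT1 x)) hr (by simp)
      _ = _ := by simp; ring
  · exact (((((hcomp i).continuous_fderiv one_ne_zero).clm_apply
      continuous_const).integrable_of_hasCompactSupport
      ((hcs i).fderiv_apply ℝ _))).integrableOn

/-- The translation estimate for sets of finite perimeter, tested against a `C¹` cutoff. -/
theorem setIntegral_translate_sub_le {d : ℕ} {F : Set (Euc d)} {r ρ : ℝ}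
    (hP : classicalPerimeter F (Metric.ball 0 r) ≠ ⊤) {ψ : Euc d → ℝ} (hψ : ContDiff ℝ 1 ψ)
    (hc : HasCompactSupport ψ) (hsupp : tsupport ψ ⊆ Metric.ball 0 ρ) (hψ1 : ∀ x, |ψ x| ≤ 1)
    {h : Euc d} (hh : ρ + ‖h‖ ≤ r) :
    ∫ x in F, ψ (x + h) ≤
      (∫ x in F, ψ x) + ‖h‖ * (classicalPerimeter F (Metric.ball 0 r)).toReal := by
  rcases eq_or_ne h 0 with rfl | hne
  · simp
  have hn : 0 < ‖h‖ := norm_pos_iff.2 hne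
  set P : ENNReal := classicalPerimeter F (Metric.ball 0 r) with hPdef
  have hG := hasDerivAt_setIntegral_translate hψ hc F h
  have hder : ∀ t ∈ interior (Icc (0 : ℝ) 1),
      deriv (fun t : ℝ => ∫ x in F, ψ (x + t • h)) t ≤ ‖h‖ * P.toReal := by
    intro t ht
    rw [interior_Icc] at ht
    rw [(hG t).deriv]
    set e : Euc d := ‖h‖⁻¹ • h with he
    have he1 : ‖e‖ = 1 := by
      rw [he, norm_smul, norm_inv, norm_norm, inv_mul_cancel₀ hn.ne']
    -- The derivative in t of the integral of ψ(x + th) over F is |h| times the integral of div T,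
    -- and T is admissible in B_r because t < 1 and ρ + |h| ≤ r.
    set T : Euc d → Euc d := fun x => ψ (x + t • h) • e with hT
    have hψt : ContDiff ℝ 1 fun x : Euc d => ψ (x + t • h) := hψ.comp (by fun_prop)
    have hTd : ContDiff ℝ 1 T := hψt.smul contDiff_const
    have hcs : HasCompactSupport fun x => ψ (x + t • h) :=
      hc.comp_homeomorph (Homeomorph.addRight (t • h))
    have hTc : HasCompactSupport T := hcs.smul_right
    have hTs : tsupport T ⊆ Metric.ball 0 r := by
      intro x hx
      have h1 : x + t • h ∈ tsupport ψ := by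
        have h2 : tsupport T ⊆ (fun x => x + t • h) ⁻¹' tsupport ψ := by
          refine closure_minimal (fun y hy => subset_closure ?_)
            ((isClosed_tsupport ψ).preimage (by fun_prop))
          intro h0
          apply hy
          simp [hT, h0]
        exact h2 hx
      have h2 := hsupp h1
      rw [mem_ball_zero_iff] at h2 ⊢
      calc ‖x‖ = ‖(x + t • h) - t • h‖ := by rw [add_sub_cancel_right]
        _ ≤ ‖x + t • h‖ + ‖t • h‖ := norm_sub_le _ _
        _ < ρ + ‖h‖ := by
            rw [norm_smul, Real.norm_of_nonneg ht.1.le]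
            have : t * ‖h‖ ≤ ‖h‖ := mul_le_of_le_one_left hn.le ht.2.le
            linarith
        _ ≤ r := hh
    have hT1 : ∀ x, ‖T x‖ ≤ 1 := fun x => by
      rw [hT, norm_smul, he1, mul_one]
      exact hψ1 _
    have hdiv : ∀ x, ‖h‖ * divergence T x = fderiv ℝ ψ (x + t • h) h := by
      intro x
      have h1 : HasFDerivAt T ((fderiv ℝ ψ (x + t • h)).smulRight e) x := by
        have h2 : HasFDerivAt (fun x => ψ (x + t • h)) (fderiv ℝ ψ (x + t • h)) x := by
          rw [← fderiv_comp_add_right]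
          exact (hψt.differentiable one_ne_zero x).hasFDerivAt
        exact h2.smul_const e
      have h3 : e = ∑ i, e i • EuclideanSpace.single i (1 : ℝ) := by
        ext j
        simp [Finset.sum_apply, Pi.single_apply]
      have h4 : divergence T x = fderiv ℝ ψ (x + t • h) e := by
        rw [divergence, h1.fderiv]
        conv_rhs => rw [h3]
        rw [map_sum]
        refine Finset.sum_congr rfl fun i _ => ?_
        rw [map_smul]
        simp [mul_comm]
      rw [h4, he, map_smul, smul_eq_mul, mul_inv_cancel_left₀ hn.ne']
    calc ∫ x in F, fderiv ℝ ψ (x + t • h) h = ‖h‖ * ∫ x in F, divergence T x := by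
          rw [← integral_const_mul]
          exact integral_congr_ae (ae_of_all _ fun x => (hdiv x).symm)
      _ ≤ ‖h‖ * P.toReal := by
          refine mul_le_mul_of_nonneg_left ?_ hn.le
          refine (ENNReal.ofReal_le_iff_le_toReal hP).1 ?_
          exact le_iSup_of_le T (le_iSup_of_le hTd (le_iSup_of_le hTc
            (le_iSup_of_le hTs (le_iSup_of_le hT1 le_rfl))))
  have hmv := (convex_Icc (0 : ℝ) 1).image_sub_le_mul_sub_of_deriv_le
    (fun t _ => (hG t).continuousAt.continuousWithinAt)
    (fun t _ => (hG t).differentiableAt.differentiableWithinAt) hder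
    0 ⟨le_rfl, zero_le_one⟩ 1 ⟨zero_le_one, le_rfl⟩ zero_le_one
  simp only [one_smul, zero_smul, add_zero, sub_zero, mul_one] at hmv
  linarith

/-- Test with a cutoff ψ equal to 1 on Q and supported in a neighbourhood U with |U \ Q| ≤ ε. As F
misses Q, the untranslated integral of ψ over F is at most ε, which is then sent to 0. -/
theorem volume_translate_compact_le {d : ℕ} {F : Set (Euc d)} {r ρ : ℝ}
    (hP : classicalPerimeter F (Metric.ball 0 r) ≠ ⊤) {Q : Set (Euc d)} (hQ : IsCompact Q)
    (hQF : Disjoint Q F) (hQρ : Q ⊆ Metric.ball 0 ρ) {h : Euc d} (hh : ρ + ‖h‖ ≤ r) :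
    volume (F ∩ (fun x => x + h) ⁻¹' Q) ≤
      ENNReal.ofReal ‖h‖ * classicalPerimeter F (Metric.ball 0 r) := by
  set P : ENNReal := classicalPerimeter F (Metric.ball 0 r) with hPdef
  have hQm := hQ.measurableSet
  refine ENNReal.le_of_forall_pos_le_add fun ε hε _ => ?_
  obtain ⟨U, hQU, hU, hUvol⟩ := hQ.exists_isOpen_lt_add (μ := volume) (ε := (ε : ENNReal))
    (by simpa using hε.ne')
  obtain ⟨V, hV, hQV, hVU, hVc⟩ := exists_open_between_and_isCompact_closure hQ
    (hU.inter Metric.isOpen_ball) (subset_inter hQU hQρ)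
  obtain ⟨ψ, hψ, hψr, hψs, hψ1⟩ := exists_contMDiff_support_eq_eq_one_iff
    (modelWithCornersSelf ℝ (Euc d)) (n := 1) hV hQ.isClosed hQV
  have hψd : ContDiff ℝ 1 ψ := hψ.contDiff
  have hψ01 : ∀ x, ψ x ∈ Icc (0 : ℝ) 1 := fun x => hψr ⟨x, rfl⟩
  have hts : tsupport ψ ⊆ U ∩ Metric.ball 0 ρ := by rw [tsupport, hψs]; exact hVU
  have hψc : HasCompactSupport ψ := by
    rw [HasCompactSupport, tsupport, hψs]; exact hVc
  have hmain := setIntegral_translate_sub_le hP hψd hψc (hts.trans inter_subset_right)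
    (fun x => abs_le.2 ⟨by linarith [(hψ01 x).1], (hψ01 x).2⟩) hh
  have hint : Integrable ψ := hψd.continuous.integrable_of_hasCompactSupport hψc
  have hint' : Integrable fun x => ψ (x + h) := hint.comp_add_right h
  have hleft : volume (F ∩ (fun x => x + h) ⁻¹' Q) ≤ ENNReal.ofReal (∫ x in F, ψ (x + h)) := by
    rw [ofReal_integral_eq_lintegral_ofReal hint'.integrableOn
      (ae_of_all _ fun x => (hψ01 _).1)]
    have hm : MeasurableSet ((fun x : Euc d => x + h) ⁻¹' Q) :=
      (by fun_prop : Measurable fun x : Euc d => x + h) hQm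
    calc _ = ∫⁻ x in F, ((fun x => x + h) ⁻¹' Q).indicator (fun _ => 1) x := by
          rw [lintegral_indicator_const hm, one_mul, Measure.restrict_apply hm, inter_comm]
      _ ≤ _ := by
          refine lintegral_mono fun x => ?_
          by_cases hx : x + h ∈ Q
          · rw [(hψ1 _).1 hx]
            simp [indicator]
            split_ifs <;> simp
          · rw [indicator_of_notMem (by exact hx)]
            exact zero_le
  have hright : ENNReal.ofReal (∫ x in F, ψ x) ≤ ε := by
    rw [ofReal_integral_eq_lintegral_ofReal hint.integrableOn (ae_of_all _ fun x => (hψ01 _).1)]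
    calc _ ≤ ∫⁻ x in F, U.indicator (fun _ => 1) x := by
          refine lintegral_mono fun x => ?_
          by_cases hx : x ∈ U
          · rw [indicator_of_mem hx]
            exact ENNReal.ofReal_le_one.2 (hψ01 x).2
          · have : ψ x = 0 := by
              by_contra h0
              exact hx (hts (subset_closure h0)).1
            simp [this]
      _ = volume (U ∩ F) := by
          rw [lintegral_indicator_const hU.measurableSet, one_mul,
            Measure.restrict_apply hU.measurableSet]
      _ ≤ volume (U \ Q) :=
          measure_mono fun x hx => ⟨hx.1, fun hxQ => hQF.le_bot ⟨hxQ, hx.2⟩⟩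
      _ = volume U - volume Q :=
          measure_sdiff hQU hQm.nullMeasurableSet hQ.measure_lt_top.ne
      _ ≤ ε := tsub_le_iff_left.2 hUvol.le
  calc _ ≤ ENNReal.ofReal (∫ x in F, ψ (x + h)) := hleft
    _ ≤ ENNReal.ofReal ((∫ x in F, ψ x) + ‖h‖ * P.toReal) := ENNReal.ofReal_le_ofReal hmain
    _ ≤ ENNReal.ofReal (∫ x in F, ψ x) + ENNReal.ofReal (‖h‖ * P.toReal) := ENNReal.ofReal_add_le
    _ ≤ ε + ENNReal.ofReal ‖h‖ * P := by
        rw [ENNReal.ofReal_mul (norm_nonneg _), ENNReal.ofReal_toReal hP]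
        exact add_le_add_left hright _
    _ = _ := add_comm _ _

/-- A relative isoperimetric inequality on balls. -/
theorem volume_mul_volume_compl_le {d : ℕ} {F : Set (Euc d)} (hF : MeasurableSet F) {ρ : ℝ}
    (hρ : 0 < ρ) :
    volume (F ∩ Metric.ball 0 ρ) * volume (Fᶜ ∩ Metric.ball 0 ρ) ≤
      ENNReal.ofReal (2 * ρ * (ballVolume d * (2 * ρ) ^ d)) *
        classicalPerimeter F (Metric.ball 0 (3 * ρ)) := by
  have hω := ballVolume_pos d
  set P : ENNReal := classicalPerimeter F (Metric.ball 0 (3 * ρ)) with hPdef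
  by_cases hP : P = ⊤
  · rw [hP, ENNReal.mul_top]
    · exact le_top
    · simp only [ne_eq, ENNReal.ofReal_eq_zero, not_le]; positivity
  have hcm : MeasurableSet (Fᶜ ∩ Metric.ball 0 ρ) := hF.compl.inter Metric.isOpen_ball.measurableSet
  -- Inner regularity replaces the complementary phase by compact subsets Q, as the cutoff argument
  -- requires.
  rw [hcm.measure_eq_iSup_isCompact_of_ne_top
    ((measure_mono inter_subset_right).trans_lt Metric.isBounded_ball.measure_lt_top).ne]
  simp only [ENNReal.mul_iSup]
  refine iSup_le fun Q => iSup_le fun hQs => iSup_le fun hQ => ?_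
  have hQm := hQ.measurableSet
  have hm : Measurable fun q : Euc d × Euc d =>
      Q.indicator (fun _ => (1 : ENNReal)) (q.1 + q.2) :=
    (measurable_const.indicator hQm).comp (by fun_prop)
  calc volume (F ∩ Metric.ball 0 ρ) * volume Q
      = ∫⁻ _ in F ∩ Metric.ball 0 ρ, volume Q := by rw [setLIntegral_const, mul_comm]
    -- Two points of B_ρ differ by some h with |h| < 2ρ, so the product of volumes is an integral
    -- over such h; ρ + |h| ≤ 3ρ explains the larger ball in the perimeter.
    _ ≤ ∫⁻ x in F ∩ Metric.ball 0 ρ, ∫⁻ h in Metric.ball (0 : Euc d) (2 * ρ),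
          Q.indicator (fun _ => 1) (x + h) := by
        refine setLIntegral_mono' (hF.inter Metric.isOpen_ball.measurableSet) fun x hx => ?_
        rw [← one_mul (volume Q), ← lintegral_indicator_const hQm,
          ← lintegral_add_left_eq_self _ x, ← lintegral_indicator Metric.isOpen_ball.measurableSet]
        refine lintegral_mono fun h => ?_
        by_cases hxh : x + h ∈ Q
        · rw [indicator_of_mem (s := Metric.ball (0 : Euc d) (2 * ρ))]
          have h1 := (hQs hxh).2
          have h2 := hx.2
          rw [mem_ball_zero_iff] at h1 h2 ⊢
          calc ‖h‖ = ‖(x + h) - x‖ := by rw [add_sub_cancel_left]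
            _ ≤ ‖x + h‖ + ‖x‖ := norm_sub_le _ _
            _ < 2 * ρ := by linarith
        · rw [indicator_of_notMem hxh]
          exact zero_le
    _ = ∫⁻ h in Metric.ball (0 : Euc d) (2 * ρ), ∫⁻ x in F ∩ Metric.ball 0 ρ,
          Q.indicator (fun _ => 1) (x + h) := lintegral_lintegral_swap hm.aemeasurable
    _ ≤ ∫⁻ h in Metric.ball (0 : Euc d) (2 * ρ), ENNReal.ofReal (2 * ρ) * P := by
        refine setLIntegral_mono' Metric.isOpen_ball.measurableSet fun h hh => ?_
        rw [mem_ball_zero_iff] at hh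
        have hpm : MeasurableSet ((fun x : Euc d => x + h) ⁻¹' Q) :=
          (by fun_prop : Measurable fun x : Euc d => x + h) hQm
        calc _ ≤ ∫⁻ x in F, ((fun x => x + h) ⁻¹' Q).indicator (fun _ => 1) x :=
              lintegral_mono_set inter_subset_left
          _ = volume (F ∩ (fun x => x + h) ⁻¹' Q) := by
              rw [lintegral_indicator_const hpm, one_mul, Measure.restrict_apply hpm, inter_comm]
          _ ≤ ENNReal.ofReal ‖h‖ * P := volume_translate_compact_le hP hQ
              (disjoint_left.2 fun x hx => (hQs hx).1) (fun x hx => (hQs hx).2) (by linarith)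
          _ ≤ _ := mul_le_mul_left (ENNReal.ofReal_le_ofReal hh.le) _
    _ = _ := by
        rw [setLIntegral_const, volume_ball_eq _ (by positivity),
          ENNReal.ofReal_mul (p := 2 * ρ) (by positivity)]
        ring

theorem le_classicalPerimeter {d : ℕ} (hd : 1 ≤ d) {c : ℝ} (hc : 0 < c) {r : ℝ} (hr : 0 < r)
    {F : Set (Euc d)} (hF : MeasurableSet F)
    (h1 : ENNReal.ofReal (c * (r / 3) ^ d) ≤ volume (F ∩ Metric.ball 0 (r / 3)))
    (h2 : ENNReal.ofReal (c * (r / 3) ^ d) ≤ volume (Fᶜ ∩ Metric.ball 0 (r / 3))) :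
    ENNReal.ofReal (c ^ 2 / (2 * (ballVolume d * 2 ^ d) * 3 ^ (d - 1)) * r ^ (d - 1)) ≤
      classicalPerimeter F (Metric.ball 0 r) := by
  have hω := ballVolume_pos d
  have h := (mul_le_mul' h1 h2).trans (volume_mul_volume_compl_le hF (show 0 < r / 3 by positivity))
  rw [mul_div_cancel₀ r (by norm_num : (3 : ℝ) ≠ 0)] at h
  have hk : 0 < 2 * (r / 3) * (ballVolume d * (2 * (r / 3)) ^ d) := by positivity
  rw [← ENNReal.mul_le_mul_iff_right
    (a := ENNReal.ofReal (2 * (r / 3) * (ballVolume d * (2 * (r / 3)) ^ d))) (by simpa using hk)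
    ENNReal.ofReal_ne_top]
  refine le_trans (le_of_eq ?_) h
  rw [← ENNReal.ofReal_mul hk.le, ← ENNReal.ofReal_mul (by positivity)]
  congr 1
  have e1 : (r / 3) ^ d = (r / 3) ^ (d - 1) * (r / 3) := by
    rw [← pow_succ, Nat.sub_add_cancel hd]
  rw [mul_pow 2 (r / 3), e1, div_pow]
  field_simp

end NonlocalMinimal

/-! ### Comparison with the perimeter of the ball. -/

open NonlocalMinimal in
theorem corollary1p5 (d : ℕ) (hd : 1 ≤ d) (s lam Lam : ℝ) (hs : s ∈ Set.Ioo (0 : ℝ) 1)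
    (hlam : 0 < lam) (hLam : lam ≤ Lam) :
    (∀ α ∈ Set.Ioc (0 : ℝ) 1, ∃ δ : ℝ, 0 < δ ∧
      ∀ K : EuclideanSpace ℝ (Fin d) → ℝ, NonlocalMinimal.IsEllipticKernel s lam Lam K →
      ∀ E : Set (EuclideanSpace ℝ (Fin d)), MeasurableSet E → volume (frontier E) = 0 →
        (0 : EuclideanSpace ℝ (Fin d)) ∈ frontier E →
        NonlocalMinimal.ViscosityEq K E Set.univ 0 →
        ∀ r : ℝ, 0 < r →
          ENNReal.ofReal δ * NonlocalMinimal.perimeter α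
              (Metric.ball (0 : EuclideanSpace ℝ (Fin d)) r) Set.univ
            ≤ NonlocalMinimal.perimeter α E (Metric.ball 0 r)) ∧
    (∃ C : ℝ, 0 < C ∧
      ∀ K : EuclideanSpace ℝ (Fin d) → ℝ, NonlocalMinimal.IsEllipticKernel s lam Lam K →
      ∀ E : Set (EuclideanSpace ℝ (Fin d)), MeasurableSet E → volume (frontier E) = 0 →
        (0 : EuclideanSpace ℝ (Fin d)) ∈ frontier E →
        NonlocalMinimal.ViscosityEq K E Set.univ 0 →
        ∀ r : ℝ, 0 < r →
          ENNReal.ofReal (C * r ^ (d - 1))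
            ≤ NonlocalMinimal.classicalPerimeter E (Metric.ball 0 r)) := by
  have hω := ballVolume_pos d
  obtain ⟨c, hc, hdens⟩ := exists_density_const d hd hs hlam (hlam.le.trans hLam)
  have hclass : ∃ C : ℝ, 0 < C ∧
      ∀ K : Euc d → ℝ, IsEllipticKernel s lam Lam K →
      ∀ E : Set (Euc d), MeasurableSet E → volume (frontier E) = 0 →
        (0 : Euc d) ∈ frontier E → ViscosityEq K E Set.univ 0 → ∀ r : ℝ, 0 < r →
          ENNReal.ofReal (C * r ^ (d - 1)) ≤ classicalPerimeter E (Metric.ball 0 r) := by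
    refine ⟨c ^ 2 / (2 * (ballVolume d * 2 ^ d) * 3 ^ (d - 1)), by positivity,
      fun K hK E hE hnull h0 hvis r hr => ?_⟩
    obtain ⟨h1, h2⟩ := hdens K hK E hE hnull h0 hvis (r / 3) (by positivity)
    exact le_classicalPerimeter hd hc hr hE h1 h2
  refine ⟨fun α hα => ?_, hclass⟩
  rcases eq_or_ne α 1 with rfl | hne
  · obtain ⟨C, hC, hlow⟩ := hclass
    have hd0 : (0 : ℝ) < d := by exact_mod_cast hd
    have hk : 0 < 2 * (d : ℝ) ^ 2 * ballVolume d := by positivity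
    refine ⟨C / (2 * (d : ℝ) ^ 2 * ballVolume d), by positivity,
      fun K hK E hE hnull h0 hvis r hr => ?_⟩
    simp only [perimeter, if_true]
    refine (mul_le_mul_right (classicalPerimeter_ball_le hd hr) _).trans
      (le_trans (le_of_eq ?_) (hlow K hK E hE hnull h0 hvis r hr))
    rw [← ENNReal.ofReal_mul (by positivity), ← mul_assoc, div_mul_cancel₀ _ hk.ne']
  · obtain ⟨C, hC, hup⟩ := fractionalPerimeter_ball_le hd ⟨hα.1, lt_of_le_of_ne hα.2 hne⟩
    -- δ is the lower constant for E divided by the upper constant for the ball; both bounds scale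
    -- as r^{d-α}.
    refine ⟨c ^ 2 / 2 / 2 ^ ((d : ℝ) + α) / C, by positivity,
      fun K hK E hE hnull h0 hvis r hr => ?_⟩
    obtain ⟨h1, h2⟩ := hdens K hK E hE hnull h0 hvis r hr
    simp only [perimeter, if_neg hne]
    refine (mul_le_mul_right (hup r hr) _).trans
      (le_trans (le_of_eq ?_) (le_fractionalPerimeter hα.1 hc hr hE h1 h2))
    rw [← ENNReal.ofReal_mul (by positivity), ← mul_assoc, div_mul_cancel₀ _ hC.ne']

end
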